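/- Let $K$ be a commutative ring, $\delta\in K$ and $n\ge 1$. A two-colour diagram on $m$ strings is a perfect matching, by strings, of $m$ points on the top edge and $m$ points on the bottom edge of a rectangle, each string being coloured $1$ or $2$, such that strings of the same colour do not cross (strings of different colours may cross); diagrams are taken up to isotopy, that is, only the matching and the colours matter. The two-colour Temperley–Lieb algebra $T^{(2)}(m)$ is the free $K$-module on these diagrams, where the product $D_1D_2$ is obtained by placing $D_1$ on top of $D_2$: it is $0$ if the colours along the common edge do not match, and otherwise it is $\delta^{\ell}$ times the resulting diagram, where $\ell$ is the number of closed loops (of either colour), which are removed. Let $T^{S(2)}(m)$ be the subalgebra of elements fixed by the involution that interchanges the two colours. Regard $T^{(2)}(n)$ as a subalgebra of $T^{(2)}(n+1)$ by sending a diagram to the sum of the two diagrams obtained by adding on the right a vertical string of colour $1$ or of colour $2$. In $T^{(2)}(n+1)$, for $1\le i\le n$, let $\pi_j(c)$ be the sum of all colourings of the identity diagram in which string $j$ has colour $c$; let $\sigma_i(c,d)$ be the sum of all colourings (with strings of the same colour not crossing) of the diagram of the transposition $(i,i+1)$ in which the string from $i$ to $i+1$ has colour $c$ and the string from $i+1$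 to $i$ has colour $d$; and let $u_i(c,d)$ be the sum of all colourings of the standard Temperley–Lieb diagram $U_i$ (an arc joining the top points $i,i+1$, an arc joining the bottom points $i,i+1$, and all other strings vertical) in which the top arc has colour $c$ and the bottom arc has colour $d$. Put $$e_i=\pi_i(1)\pi_{i+1}(1)+\pi_i(2)\pi_{i+1}(2),\qquad s_i=\sigma_i(1,2)+\sigma_i(2,1),$$ $$u_i=u_i(1,1)+u_i(2,2),\qquad t_i=u_i(1,2)+u_i(2,1).$$ Then $$T^{S(2)}(n+1)=T^{S(2)}(n)+T^{S(2)}(n)\,e_n\,T^{S(2)}(n)+T^{S(2)}(n)\,s_n\,T^{S(2)}(n)+T^{S(2)}(n)\,u_n\,T^{S(2)}(n)+T^{S(2)}(n)\,t_n\,T^{S(2)}(n),$$ where $T^{S(2)}(n)\,x\,T^{S(2)}(n)$ denotes the $K$-span of the products $axb$ with $a,b\in T^{S(2)}(n)$. -/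

import Mathlib

noncomputable section

namespace DiluteTL

/-- The boundary points of a diagram on `n` strings: `Sum.inl i` is the `i`-th point of the top
edge, `Sum.inr i` is the `i`-th point of the bottom edge (both counted from the left, from `0`). -/
abbrev Pt (n : ℕ) : Type := Fin n ⊕ Fin n

/-- The place of a boundary point when the boundary of the rectangle is traversed clockwise,
starting at the top left corner: the top edge from left to right, then the bottom edge from right
to left. -/
def pos {n : ℕ} : Pt n → ℕ
  | Sum.inl i => (i : ℕ)
  | Sum.inr i => 2 * n - 1 - (i : ℕ)

/-- A two-colour Temperley--Lieb diagram on `n` strings, up to isotopy: a perfect matching of the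
`2 n` boundary points (given by the map sending a point to the other end of its string) whose
strings are coloured by two colours, such that strings of the same colour do not cross. Strings of
different colours may cross. The colours `1`, `2` are `false`, `true`. -/
@[ext]
structure Diagram (n : ℕ) where
  color : Pt n → Bool
  partner : Pt n → Pt n
  partner_partner : ∀ x, partner (partner x) = x
  partner_ne : ∀ x, partner x ≠ x
  color_partner : ∀ x, color (partner x) = color x
  noncrossing : ∀ x y, color x = color y →
    ¬ (pos x < pos y ∧ pos y < pos (partner x) ∧ pos (partner x) < pos (partner y))

instance instFintypeDiagram (n : ℕ) : Fintype (Diagram n) :=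
  Fintype.ofInjective (fun D : Diagram n => (D.color, D.partner)) (by
    intro D E h
    exact Diagram.ext (congrArg Prod.fst h) (congrArg Prod.snd h))

/-- Interchange of the two colours of a diagram. -/
def Diagram.swap {n : ℕ} (D : Diagram n) : Diagram n where
  color x := !(D.color x)
  partner := D.partner
  partner_partner := D.partner_partner
  partner_ne := D.partner_ne
  color_partner x := by rw [D.color_partner]
  noncrossing x y h := D.noncrossing x y (Bool.not_inj h)

/-! ### Gluing two diagrams

When `D₁` is put on top of `D₂`, the points involved form three rows: row `0` is the top edge of
`D₁`, row `1` is the bottom edge of `D₁` identified with the top edge of `D₂`, and row `2` is the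
bottom edge of `D₂`. -/

/-- The boundary points of the upper diagram among the three rows. -/
def upper {n : ℕ} : Pt n → Fin 3 × Fin n
  | Sum.inl i => (0, i)
  | Sum.inr i => (1, i)

/-- The boundary points of the lower diagram among the three rows. -/
def lower {n : ℕ} : Pt n → Fin 3 × Fin n
  | Sum.inl i => (1, i)
  | Sum.inr i => (2, i)

/-- The boundary points of the glued picture among the three rows. -/
def outer {n : ℕ} : Pt n → Fin 3 × Fin n
  | Sum.inl i => (0, i)
  | Sum.inr i => (2, i)

/-- Two points of the glued picture are joined by a string of `D₁` or by a string of `D₂`. -/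
def Joined {n : ℕ} (D₁ D₂ : Diagram n) (x y : Fin 3 × Fin n) : Prop :=
  (∃ p, x = upper p ∧ y = upper (D₁.partner p)) ∨ (∃ p, x = lower p ∧ y = lower (D₂.partner p))

/-- The relation of lying on the same connected component of the glued picture. -/
def component {n : ℕ} (D₁ D₂ : Diagram n) : Setoid (Fin 3 × Fin n) :=
  Relation.EqvGen.setoid (Joined D₁ D₂)

/-- The number of closed loops of the glued picture: the components without an outer point. -/
def loops {n : ℕ} (D₁ D₂ : Diagram n) : ℕ :=
  Set.ncard {q : Quotient (component D₁ D₂) | ∀ p : Pt n, q ≠ Quotient.mk _ (outer p)}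

/-- `E` is the diagram obtained by gluing `D₁` on top of `D₂` and deleting the closed loops. The
colours have to agree along the common edge, and the two ends of each string of `E` are the
two outer points of one component of the glued picture. -/
structure IsComposite {n : ℕ} (D₁ D₂ E : Diagram n) : Prop where
  color_middle : ∀ i, D₁.color (Sum.inr i) = D₂.color (Sum.inl i)
  color_top : ∀ i, E.color (Sum.inl i) = D₁.color (Sum.inl i)
  color_bottom : ∀ i, E.color (Sum.inr i) = D₂.color (Sum.inr i)
  joined : ∀ p, component D₁ D₂ (outer p) (outer (E.partner p))

/-! ### The two-colour Temperley--Lieb algebra -/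

variable {K : Type*} [CommRing K]

/-- The two-colour Temperley--Lieb algebra `T⁽²⁾(n)` over `K`, both loop parameters being `δ`: the
free `K`-module on the two-colour diagrams. The element `a` is `∑ D, a D • D`. -/
def TL2 (_δ : K) (n : ℕ) : Type _ := Diagram n → K

instance instAddCommGroupTL2 (δ : K) (n : ℕ) : AddCommGroup (TL2 δ n) :=
  inferInstanceAs (AddCommGroup (Diagram n → K))

instance instModuleTL2 (δ : K) (n : ℕ) : Module K (TL2 δ n) :=
  inferInstanceAs (Module K (Diagram n → K))

open Classical in
/-- The coefficient of the diagram `E` in the product of the diagrams `D₁` and `D₂`. -/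
def structConst (δ : K) {n : ℕ} (D₁ D₂ E : Diagram n) : K :=
  if IsComposite D₁ D₂ E then δ ^ loops D₁ D₂ else 0

/-- The product of `T⁽²⁾(n)`: the bilinear map for which `D₁ * D₂` is `δ` to the number of closed
loops times the composite diagram if the colours match along the common edge, and `0` if not. -/
instance instMulTL2 (δ : K) (n : ℕ) : Mul (TL2 δ n) where
  mul a b := fun E => ∑ D₁, ∑ D₂, a D₁ * b D₂ * structConst δ D₁ D₂ E

/-- The sum of all diagrams with a given property. -/
def diagramSum (δ : K) {n : ℕ} (P : Diagram n → Prop) : TL2 δ n :=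
  Set.indicator {D | P D} (fun _ => 1)

/-- The involution of `T⁽²⁾(n)` which interchanges the two colours. -/
def colorSwap (δ : K) (n : ℕ) : TL2 δ n →ₗ[K] TL2 δ n where
  toFun a := fun D => a D.swap
  map_add' _ _ := rfl
  map_smul' _ _ := rfl

/-- `T^{S(2)}(n)`, the elements of `T⁽²⁾(n)` fixed by the interchange of the two colours. -/
def TS2 (δ : K) (n : ℕ) : Submodule K (TL2 δ n) :=
  LinearMap.eqLocus (colorSwap δ n) LinearMap.id

/-! ### The inclusion of `T⁽²⁾(n)` in `T⁽²⁾(n+1)` -/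

/-- A boundary point of a diagram on `n` strings as a point of a diagram on `n + 1` strings. -/
def liftPt {n : ℕ} : Pt n → Pt (n + 1) := Sum.map Fin.castSucc Fin.castSucc

/-- `E` is obtained from `D` by adding a vertical string (of either colour) on the right. -/
structure IsExtension {n : ℕ} (D : Diagram n) (E : Diagram (n + 1)) : Prop where
  color_lift : ∀ p, E.color (liftPt p) = D.color p
  partner_lift : ∀ p, E.partner (liftPt p) = liftPt (D.partner p)
  partner_last : E.partner (Sum.inl (Fin.last n)) = Sum.inr (Fin.last n)

open Classical in
/-- The map `a ↦ a ⊗ 1` of the tower, `1` being the identity of `T⁽²⁾(1)`: it sends a diagram `D` to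
the sum of the two diagrams obtained by adding a coloured vertical string on the right. -/
def incl (δ : K) (n : ℕ) : TL2 δ n →ₗ[K] TL2 δ (n + 1) where
  toFun a := fun E => ∑ D, if IsExtension D E then a D else 0
  map_add' a b := by
    funext E
    change (∑ D, if IsExtension D E then a D + b D else 0) =
      (∑ D, if IsExtension D E then a D else 0) + ∑ D, if IsExtension D E then b D else 0
    rw [← Finset.sum_add_distrib]
    exact Finset.sum_congr rfl fun D _ => by split_ifs <;> simp
  map_smul' r a := by
    funext E
    change (∑ D, if IsExtension D E then r * a D else 0) =
      r * ∑ D, if IsExtension D E then a D else 0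
    rw [Finset.mul_sum]
    exact Finset.sum_congr rfl fun D _ => by split_ifs <;> simp

/-! ### The elements `e_i`, `s_i`, `u_i`, `t_i`

They live in `T⁽²⁾(m+1)`. For `i : Fin m`, the two neighbouring strings involved are
`i.castSucc` and `i.succ`. -/

/-- The diagram of the identity permutation. -/
def IsIdentity {n : ℕ} (D : Diagram n) : Prop :=
  ∀ j, D.partner (Sum.inl j) = Sum.inr j

/-- The diagram of the transposition of the strings `i` and `i + 1`. -/
structure IsTransposition {m : ℕ} (i : Fin m) (D : Diagram (m + 1)) : Prop where
  left : D.partner (Sum.inl i.castSucc) = Sum.inr i.succ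
  right : D.partner (Sum.inl i.succ) = Sum.inr i.castSucc
  other : ∀ j, j ≠ i.castSucc → j ≠ i.succ → D.partner (Sum.inl j) = Sum.inr j

/-- The diagram of the standard generator `U_i` of the Temperley--Lieb algebra. -/
structure IsCupCap {m : ℕ} (i : Fin m) (D : Diagram (m + 1)) : Prop where
  top : D.partner (Sum.inl i.castSucc) = Sum.inl i.succ
  bottom : D.partner (Sum.inr i.castSucc) = Sum.inr i.succ
  other : ∀ j, j ≠ i.castSucc → j ≠ i.succ → D.partner (Sum.inl j) = Sum.inr j

/-- `π_i(c)`: the sum over all colourings of the identity with string `i` coloured `c`. -/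
def piElt (δ : K) {n : ℕ} (i : Fin n) (c : Bool) : TL2 δ n :=
  diagramSum δ fun D => IsIdentity D ∧ D.color (Sum.inl i) = c

/-- `σ_i(c,d)`: the sum over all colourings of the transposition with the string from `i` to
`i + 1` coloured `c` and the string from `i + 1` to `i` coloured `d`. -/
def sigmaElt (δ : K) {m : ℕ} (i : Fin m) (c d : Bool) : TL2 δ (m + 1) :=
  diagramSum δ fun D => IsTransposition i D ∧
    D.color (Sum.inl i.castSucc) = c ∧ D.color (Sum.inl i.succ) = d

/-- `u_i(c,d)`: the sum over all colourings of `U_i` with the top arc coloured `c` and the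
bottom arc coloured `d`. -/
def uElt (δ : K) {m : ℕ} (i : Fin m) (c d : Bool) : TL2 δ (m + 1) :=
  diagramSum δ fun D => IsCupCap i D ∧
    D.color (Sum.inl i.castSucc) = c ∧ D.color (Sum.inr i.castSucc) = d

/-- `e_i`. -/
def e (δ : K) {m : ℕ} (i : Fin m) : TL2 δ (m + 1) :=
  piElt δ i.castSucc false * piElt δ i.succ false + piElt δ i.castSucc true * piElt δ i.succ true

/-- `s_i`. -/
def s (δ : K) {m : ℕ} (i : Fin m) : TL2 δ (m + 1) :=
  sigmaElt δ i false true + sigmaElt δ i true false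

/-- `u_i`. -/
def u (δ : K) {m : ℕ} (i : Fin m) : TL2 δ (m + 1) :=
  uElt δ i false false + uElt δ i true true

/-- `t_i`. -/
def t (δ : K) {m : ℕ} (i : Fin m) : TL2 δ (m + 1) :=
  uElt δ i false true + uElt δ i true false

/-- The index `i = n` (counted from `1`), for which strings `n` and `n + 1` of `n + 1` strings are
involved. -/
def lastIndex (n : ℕ) (hn : 1 ≤ n) : Fin n := ⟨n - 1, by omega⟩

/-- The image of `T^{S(2)}(n)` in `T⁽²⁾(n+1)`. -/
def TS2incl (δ : K) (n : ℕ) : Submodule K (TL2 δ (n + 1)) :=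
  (TS2 δ n).map (incl δ n)

/-- The subspace `T^{S(2)}(n) x T^{S(2)}(n)` of `T⁽²⁾(n+1)`: the span of the products `a x b`. -/
def sandwich (δ : K) {n : ℕ} (x : TL2 δ (n + 1)) : Submodule K (TL2 δ (n + 1)) :=
  Submodule.span K {y | ∃ a ∈ TS2incl δ n, ∃ b ∈ TS2incl δ n, y = a * x * b}

end DiluteTL

end

/-!
The sums `D + D.swap` (`orbitSum`) over the orbits of the interchange of colours span `TS2`, so each
of them has to be written as a combination of products `a x b`. It turns out that each of them (or,
for a vertical last string, possibly its difference from an element of `TS2incl`) is a single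
product of this kind, obtained from a factorisation of the diagram `D` itself in which no closed
loop arises. Hence `δ` plays no role. Write `n + 1 = m + 2` for the number of strings.

* If `D` has an arc joining two top points, take one that encloses no point of its own colour
  (`exists_splits_of_top_arc`). Deleting it leaves `2 m + 2` boundary points; read in clockwise order,
  with the last bottom point becoming the last top point, they form a diagram `b` on `m + 1` strings,
  the lower factor. On top of it one puts a diagram which consists of the arc, of an arc at the bottom
  joining the last two points, and of strings joining the remaining points in increasing order
  (`Splitting.diagram`). This one is the product of a diagram `a` on `m + 1` strings and the last
  cup-cap diagram, by pulling the last top point to the bottom edge. Whether `u` or `t` has to be used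
  depends on the colours of the last top point and the last bottom point.
* If `D` has no such arc, it is a permutation diagram. Let `q` be the top end of the string `σ` that
  ends at the last bottom point. If `q` is not the last top point, all strings starting to the right
  of `q` cross `σ`, so they have the other colour (`exists_splits_of_no_top_arc`). The same
  construction applies with `s`: the lower factor is `D` without `σ`, and on top of it one puts the
  permutation diagram that moves `q` to the last place.
* If the last string of `D` is vertical, then `D` is one of the two extensions of a diagram `b`. The
  product `1 e b` is the orbit sum of one of them, and the two orbit sums add up to the image of
  that of `b` (`orbitSum_mem_of_vertical`).

The colours ensure that in the product of the sums `a + a.swap`, `x`, `b + b.swap` only one pair of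
diagrams and the pair with interchanged colours can be composed (`diagramSum_mul_diagramSum`). That a
given diagram is the composite of two others, that it is the only one, and that there are no loops,
is verified by a map from the points of the glued picture to its outer points (`Certificate`).
-/

noncomputable section

namespace DiluteTL

/-! ### Interchanging the colours -/

namespace Diagram

variable {n : ℕ}

@[simp] lemma swap_swap (D : Diagram n) : D.swap.swap = D := by
  ext <;> simp [swap]

@[simp] lemma swap_color (D : Diagram n) (x : Pt n) : D.swap.color x = !(D.color x) := rfl

@[simp] lemma swap_partner (D : Diagram n) (x : Pt n) : D.swap.partner x = D.partner x := rfl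

lemma swap_inj {D E : Diagram n} : D.swap = E.swap ↔ D = E :=
  ⟨fun h => by rw [← swap_swap D, h, swap_swap], fun h => h ▸ rfl⟩

lemma swap_eq_iff {D E : Diagram n} : D.swap = E ↔ D = E.swap := by
  rw [← swap_inj, swap_swap]

lemma ne_swap (D : Diagram (n + 1)) : D ≠ D.swap := fun h => by
  simpa using congrArg (fun E => E.color (Sum.inl 0)) h

/-- The interchange of the two colours as a permutation of the set of diagrams. -/
def swapEquiv (n : ℕ) : Diagram n ≃ Diagram n := ⟨swap, swap, swap_swap, swap_swap⟩

end Diagram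

lemma isComposite_swap {n : ℕ} {D₁ D₂ E : Diagram n} :
    IsComposite D₁.swap D₂.swap E.swap ↔ IsComposite D₁ D₂ E := by
  constructor
  · rintro ⟨h₁, h₂, h₃, h₄⟩
    exact ⟨fun i => by simpa using h₁ i, fun i => by simpa using h₂ i,
      fun i => by simpa using h₃ i, h₄⟩
  · rintro ⟨h₁, h₂, h₃, h₄⟩
    exact ⟨fun i => by simpa using h₁ i, fun i => by simpa using h₂ i,
      fun i => by simpa using h₃ i, h₄⟩

section

variable {K : Type*} [CommRing K] (δ : K) {n : ℕ}

lemma structConst_swap (D₁ D₂ E : Diagram n) :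
    structConst δ D₁.swap D₂.swap E.swap = structConst δ D₁ D₂ E := by
  classical
  unfold structConst
  exact if_congr isComposite_swap rfl rfl

variable {δ}

lemma mem_TS2 {a : TL2 δ n} : a ∈ TS2 δ n ↔ ∀ D, a D.swap = a D :=
  ⟨fun h D => congrFun h D, fun h => funext h⟩

lemma mul_mem_TS2 {a b : TL2 δ n} (ha : a ∈ TS2 δ n) (hb : b ∈ TS2 δ n) : a * b ∈ TS2 δ n := by
  rw [mem_TS2] at *
  intro E
  change (∑ D₁, ∑ D₂, a D₁ * b D₂ * structConst δ D₁ D₂ E.swap) =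
    ∑ D₁, ∑ D₂, a D₁ * b D₂ * structConst δ D₁ D₂ E
  refine Fintype.sum_equiv (Diagram.swapEquiv n) _ _ fun D₁ => ?_
  refine Fintype.sum_equiv (Diagram.swapEquiv n) _ _ fun D₂ => ?_
  change _ = a D₁.swap * b D₂.swap * structConst δ D₁.swap D₂.swap E
  rw [ha, hb, ← structConst_swap δ D₁.swap, Diagram.swap_swap, Diagram.swap_swap]

lemma diagramSum_apply (P : Diagram n → Prop) [DecidablePred P] (D : Diagram n) :
    diagramSum δ P D = if P D then 1 else 0 := by
  simp [diagramSum, Set.indicator_apply]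

lemma diagramSum_mem_TS2 {P : Diagram n → Prop} (hP : ∀ D, P D.swap ↔ P D) :
    diagramSum δ P ∈ TS2 δ n := by
  classical
  rw [mem_TS2]
  intro D
  simp [diagramSum_apply, hP]

/-- The sum of two sums of diagrams over disjoint sets. -/
lemma diagramSum_add {P Q R : Diagram n → Prop} (hR : ∀ D, R D ↔ P D ∨ Q D)
    (hd : ∀ D, P D → ¬ Q D) : diagramSum δ P + diagramSum δ Q = diagramSum δ R := by
  classical
  funext D
  change diagramSum δ P D + diagramSum δ Q D = diagramSum δ R D
  by_cases hp : P D
  · simp [diagramSum_apply, hR, hp, hd D hp]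
  · simp [diagramSum_apply, hR, hp]

variable (δ)

/-- The sum `D + D.swap` of a diagram and the diagram with interchanged colours, written as the sum
of the set `{D, D.swap}`. -/
def orbitSum (D : Diagram n) : TL2 δ n := diagramSum δ fun E => E = D ∨ E = D.swap

variable {δ}

lemma orbitSum_mem_TS2 (D : Diagram n) : orbitSum δ D ∈ TS2 δ n :=
  diagramSum_mem_TS2 fun E => by
    rw [Diagram.swap_eq_iff, Diagram.swap_inj, or_comm]

/-- The orbit sums span the elements fixed by the interchange of colours. -/
lemma TS2_le_of_orbitSum_mem {M : Submodule K (TL2 δ (n + 1))} (h : ∀ D, orbitSum δ D ∈ M) :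
    TS2 δ (n + 1) ≤ M := by
  classical
  intro a ha
  rw [mem_TS2] at ha
  -- Each orbit has one diagram whose first top point has colour `false`.
  have key : a = ∑ D : Diagram (n + 1),
      (if D.color (Sum.inl 0) = false then a D else 0) • orbitSum δ D := by
    funext E
    have e1 : (∑ D : Diagram (n + 1),
        (if D.color (Sum.inl 0) = false then a D else 0) • orbitSum δ D) E =
        ∑ D : Diagram (n + 1),
        (if D.color (Sum.inl 0) = false then a D else 0) * orbitSum δ D E :=
      Finset.sum_apply E Finset.univ
        (fun D => (if D.color (Sum.inl 0) = false then a D else 0) • orbitSum δ D)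
    have e2 : ∀ D : Diagram (n + 1), orbitSum δ D E =
        (if D = E then 1 else 0) + (if D = E.swap then 1 else 0) := by
      intro D
      rw [orbitSum, diagramSum_apply]
      have := E.ne_swap
      rw [eq_comm (a := E), eq_comm (a := E) (b := D.swap), Diagram.swap_eq_iff]
      by_cases h1 : D = E
      · subst h1; simp [this]
      · simp [h1]
    rw [e1]
    simp only [e2, mul_add, Finset.sum_add_distrib, mul_ite, mul_one, mul_zero,
      Finset.sum_ite_eq', Finset.mem_univ, if_true, Diagram.swap_color, ha]
    cases E.color (Sum.inl 0) <;> simp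
  rw [key]
  exact Submodule.sum_mem _ fun D _ => M.smul_mem _ (h D)

end

/-! ### Products without closed loops -/

section

variable {n : ℕ}

@[simp] lemma upper_inl (i : Fin n) : upper (Sum.inl i) = (0, i) := rfl

@[simp] lemma upper_inr (i : Fin n) : upper (Sum.inr i) = (1, i) := rfl

@[simp] lemma lower_inl (i : Fin n) : lower (Sum.inl i) = (1, i) := rfl

@[simp] lemma lower_inr (i : Fin n) : lower (Sum.inr i) = (2, i) := rfl

@[simp] lemma outer_inl (i : Fin n) : outer (Sum.inl i) = (0, i) := rfl

@[simp] lemma outer_inr (i : Fin n) : outer (Sum.inr i) = (2, i) := rfl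

end

section

variable {K : Type*} [CommRing K] {δ : K} {n : ℕ}

/-- A certificate that `E` is the composite of `D₁` and `D₂` and that no closed loops arise: a
map `f` which sends every point of the glued picture to an outer point on its component and which
induces a map from components to strings of `E`. -/
structure Certificate (D₁ D₂ E : Diagram n) (f : Fin 3 × Fin n → Pt n) : Prop where
  color_middle : ∀ i, D₁.color (Sum.inr i) = D₂.color (Sum.inl i)
  color_top : ∀ i, E.color (Sum.inl i) = D₁.color (Sum.inl i)
  color_bottom : ∀ i, E.color (Sum.inr i) = D₂.color (Sum.inr i)
  map_outer : ∀ p, f (outer p) = p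
  component_map : ∀ x, component D₁ D₂ x (outer (f x))
  map_upper : ∀ p, f (upper (D₁.partner p)) = f (upper p) ∨
    f (upper (D₁.partner p)) = E.partner (f (upper p))
  map_lower : ∀ p, f (lower (D₂.partner p)) = f (lower p) ∨
    f (lower (D₂.partner p)) = E.partner (f (lower p))
  joined : ∀ p, component D₁ D₂ (outer p) (outer (E.partner p))

lemma component_upper (D₁ D₂ : Diagram n) (p : Pt n) :
    component D₁ D₂ (upper p) (upper (D₁.partner p)) :=
  Relation.EqvGen.rel _ _ (Or.inl ⟨p, rfl, rfl⟩)

lemma component_lower (D₁ D₂ : Diagram n) (p : Pt n) :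
    component D₁ D₂ (lower p) (lower (D₂.partner p)) :=
  Relation.EqvGen.rel _ _ (Or.inr ⟨p, rfl, rfl⟩)

namespace Certificate

variable {D₁ D₂ E : Diagram n} {f : Fin 3 × Fin n → Pt n}

lemma isComposite (h : Certificate D₁ D₂ E f) : IsComposite D₁ D₂ E :=
  ⟨h.color_middle, h.color_top, h.color_bottom, h.joined⟩

lemma map_component (h : Certificate D₁ D₂ E f) {x y : Fin 3 × Fin n} (hxy : component D₁ D₂ x y) :
    f y = f x ∨ f y = E.partner (f x) := by
  have hxy' : Relation.EqvGen (Joined D₁ D₂) x y := hxy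
  induction hxy' with
  | rel x y hj =>
    rcases hj with ⟨p, rfl, rfl⟩ | ⟨p, rfl, rfl⟩
    · exact h.map_upper p
    · exact h.map_lower p
  | refl x => exact Or.inl rfl
  | symm x y _ ih =>
    rcases ih ‹_› with e | e
    · exact Or.inl e.symm
    · exact Or.inr (by rw [e, E.partner_partner])
  | trans x y z h1 h2 ih1 ih2 =>
    rcases ih1 h1 with e | e <;> rcases ih2 h2 with e' | e' <;> rw [e', e]
    · simp
    · simp
    · simp
    · exact Or.inl (E.partner_partner _)

lemma loops_eq_zero (h : Certificate D₁ D₂ E f) : loops D₁ D₂ = 0 := by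
  rw [loops, Set.ncard_eq_zero]
  ext q
  induction q using Quotient.inductionOn with | _ x => ?_
  simp only [Set.mem_ofPred_eq, Set.mem_empty_iff_false, iff_false, not_forall, not_not]
  exact ⟨f x, Quotient.sound (h.component_map x)⟩

lemma eq_of_isComposite (h : Certificate D₁ D₂ E f) {G : Diagram n} (hG : IsComposite D₁ D₂ G) :
    G = E := by
  refine Diagram.ext (funext fun p => ?_) (funext fun p => ?_)
  · rcases p with i | i
    · rw [hG.color_top, h.color_top]
    · rw [hG.color_bottom, h.color_bottom]
  · have := h.map_component (hG.joined p)
    simp only [h.map_outer] at this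
    exact this.resolve_left (G.partner_ne p)

open Classical in
lemma structConst_eq (h : Certificate D₁ D₂ E f) (G : Diagram n) :
    structConst δ D₁ D₂ G = if G = E then 1 else 0 := by
  unfold structConst
  by_cases hG : G = E
  · subst hG
    rw [if_pos h.isComposite, if_pos rfl, h.loops_eq_zero, pow_zero]
  · rw [if_neg fun h' => hG (h.eq_of_isComposite h'), if_neg hG]

end Certificate

lemma structConst_eq_zero {D₁ D₂ E : Diagram n}
    (h : ¬ ∀ i, D₁.color (Sum.inr i) = D₂.color (Sum.inl i)) : structConst δ D₁ D₂ E = 0 := by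
  classical
  exact if_neg fun h' => h h'.color_middle

/-- If, up to the interchange of colours, only one diagram of the first sum and one diagram of the
second sum have matching colours, then the product is the orbit sum of their composite. -/
lemma diagramSum_mul_diagramSum {P Q : Diagram (n + 1) → Prop} {V W E : Diagram (n + 1)}
    {f : Fin 3 × Fin (n + 1) → Pt (n + 1)} (hf : Certificate V W E f) (hV : P V) (hW : Q W)
    (hQ : ∀ w, Q w → Q w.swap)
    (huniq : ∀ v w, P v → Q w → (∀ i, v.color (Sum.inr i) = w.color (Sum.inl i)) →
      v = V ∧ w = W) :
    diagramSum δ (fun v => P v ∨ P v.swap) * diagramSum δ Q = orbitSum δ E := by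
  classical
  funext G
  change (∑ v, ∑ w, diagramSum δ (fun v => P v ∨ P v.swap) v * diagramSum δ Q w *
    structConst δ v w G) = _
  have key : ∀ v w, diagramSum δ (fun v => P v ∨ P v.swap) v * diagramSum δ Q w *
      structConst δ v w G =
      (if w = W then if v = V then if G = E then 1 else 0 else 0 else 0) +
      (if w = W.swap then if v = V.swap then if G = E.swap then 1 else 0 else 0 else 0) := by
    intro v w
    have s1 : structConst δ V W G = if G = E then 1 else 0 := hf.structConst_eq G
    have s2 : structConst δ V.swap W.swap G = if G = E.swap then 1 else 0 := by
      rw [← Diagram.swap_swap G, structConst_swap, hf.structConst_eq]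
      simp only [Diagram.swap_eq_iff, Diagram.swap_swap]
    by_cases h1 : v = V ∧ w = W
    · obtain ⟨rfl, rfl⟩ := h1
      simp [diagramSum_apply, hV, hW, s1, Diagram.ne_swap]
    by_cases h2 : v = V.swap ∧ w = W.swap
    · obtain ⟨rfl, rfl⟩ := h2
      simp [diagramSum_apply, hV, hQ W hW, s2, (Diagram.ne_swap _).symm]
    have rhs : (if w = W then if v = V then if G = E then (1 : K) else 0 else 0 else 0) +
        (if w = W.swap then if v = V.swap then if G = E.swap then 1 else 0 else 0 else 0) = 0 := by
      have z : ∀ (v₀ w₀ : Diagram (n + 1)) (r : K), ¬ (v = v₀ ∧ w = w₀) →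
          (if w = w₀ then if v = v₀ then r else 0 else 0) = 0 := by
        intro v₀ w₀ r h
        by_cases hw : w = w₀
        · rw [if_pos hw, if_neg fun hv => h ⟨hv, hw⟩]
        · rw [if_neg hw]
      rw [z _ _ _ h1, z _ _ _ h2, add_zero]
    rw [rhs]
    by_cases hw : Q w
    swap
    · simp [diagramSum_apply, hw]
    by_cases hc : ∀ i, v.color (Sum.inr i) = w.color (Sum.inl i)
    swap
    · rw [structConst_eq_zero hc, mul_zero]
    rw [diagramSum_apply, if_neg, zero_mul, zero_mul]
    rintro (hv | hv)
    · exact h1 (huniq v w hv hw hc)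
    · have := huniq v.swap w.swap hv (hQ w hw) (fun i => by simp [hc])
      exact h2 ⟨Diagram.swap_eq_iff.1 this.1, Diagram.swap_eq_iff.1 this.2⟩
  have := E.ne_swap
  simp only [key, Finset.sum_add_distrib, Finset.sum_ite_eq', Finset.mem_univ, if_true]
  rw [orbitSum, diagramSum_apply]
  by_cases h1 : G = E
  · subst h1; simp [this]
  · simp [h1]

end

/-! ### Positions on the boundary -/

section

variable {n : ℕ}

@[simp] lemma pos_inl (i : Fin n) : pos (Sum.inl i : Pt n) = i := rfl

@[simp] lemma pos_inr (i : Fin n) : pos (Sum.inr i : Pt n) = 2 * n - 1 - (i : ℕ) := rfl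

lemma pos_injective : Function.Injective (pos : Pt n → ℕ) := by
  rintro (i | i) (j | j) h <;> simp only [pos_inl, pos_inr] at h
  · exact congrArg _ (Fin.ext h)
  · omega
  · omega
  · exact congrArg _ (Fin.ext (by omega))

lemma pos_liftPt_lt {x y : Pt n} (h : pos x < pos y) : pos (liftPt x) < pos (liftPt y) := by
  rcases x with i | i <;> rcases y with j | j <;> simp [liftPt] at h ⊢ <;> omega

lemma Diagram.partner_eq_comm (D : Diagram n) {x y : Pt n} : D.partner x = y ↔ D.partner y = x :=
  ⟨fun h => by rw [← h, D.partner_partner], fun h => by rw [← h, D.partner_partner]⟩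

lemma Diagram.partner_injective (D : Diagram n) : Function.Injective D.partner :=
  fun x y h => by rw [← D.partner_partner x, h, D.partner_partner]

lemma forall_pt_succ {motive : Pt (n + 1) → Prop} (hl : ∀ p, motive (liftPt p))
    (ht : motive (Sum.inl (Fin.last n))) (hb : motive (Sum.inr (Fin.last n))) :
    ∀ p, motive p := by
  rintro (i | i) <;> cases i using Fin.lastCases with
  | last => assumption
  | cast i => first | exact hl (Sum.inl i) | exact hl (Sum.inr i)

lemma liftPt_injective : Function.Injective (liftPt : Pt n → Pt (n + 1)) :=
  Sum.map_injective.2 ⟨Fin.castSucc_injective n, Fin.castSucc_injective n⟩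

lemma liftPt_ne_inl_last (p : Pt n) : liftPt p ≠ Sum.inl (Fin.last n) := by
  rcases p with i | i <;> simp [liftPt]

lemma liftPt_ne_inr_last (p : Pt n) : liftPt p ≠ Sum.inr (Fin.last n) := by
  rcases p with i | i <;> simp [liftPt]

/-- The diagram on fewer strings obtained by transporting part of the strings of `D` along a map of
boundary points which preserves the clockwise order and whose image is a union of strings. -/
def Diagram.comap {m : ℕ} (D : Diagram m) (ε : Pt n → Pt m)
    (hε : ∀ x y, pos x < pos y → pos (ε x) < pos (ε y))
    (hD : ∀ x, ∃ y, ε y = D.partner (ε x)) : Diagram n :=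
  have inj : Function.Injective ε := fun x y h => by
    by_contra hne
    rcases lt_or_gt_of_ne (pos_injective.ne hne) with h' | h'
    · exact (hε _ _ h').ne (by rw [h])
    · exact (hε _ _ h').ne (by rw [h])
  { color := D.color ∘ ε
    partner := fun x => (hD x).choose
    partner_partner := fun x => inj (by
      rw [(hD _).choose_spec, (hD x).choose_spec, D.partner_partner])
    partner_ne := fun x h => D.partner_ne (ε x) (by rw [← (hD x).choose_spec, h])
    color_partner := fun x => by
      rw [Function.comp_apply, (hD x).choose_spec, D.color_partner, Function.comp_apply]
    noncrossing := fun x y h ⟨h1, h2, h3⟩ => D.noncrossing (ε x) (ε y) h ⟨hε _ _ h1, by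
      rw [← (hD x).choose_spec]; exact hε _ _ h2, by
      rw [← (hD x).choose_spec, ← (hD y).choose_spec]; exact hε _ _ h3⟩ }

lemma Diagram.map_comap_partner {m : ℕ} (D : Diagram m) (ε : Pt n → Pt m)
    (hε : ∀ x y, pos x < pos y → pos (ε x) < pos (ε y))
    (hD : ∀ x, ∃ y, ε y = D.partner (ε x)) (x : Pt n) :
    ε ((D.comap ε hε hD).partner x) = D.partner (ε x) := (hD x).choose_spec

/-! ### Adding a vertical string -/

/-- The diagram obtained by adding a vertical string of a given colour on the right. -/
def Diagram.extend (D : Diagram n) (c : Bool) : Diagram (n + 1) where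
  color := Sum.elim (Fin.lastCases c fun i => D.color (Sum.inl i))
    (Fin.lastCases c fun i => D.color (Sum.inr i))
  partner := Sum.elim
    (Fin.lastCases (Sum.inr (Fin.last n)) fun i => liftPt (D.partner (Sum.inl i)))
    (Fin.lastCases (Sum.inl (Fin.last n)) fun i => liftPt (D.partner (Sum.inr i)))
  partner_partner := forall_pt_succ (by
      have h : ∀ p, Sum.elim
          (Fin.lastCases (Sum.inr (Fin.last n)) fun i => liftPt (D.partner (Sum.inl i)))
          (Fin.lastCases (Sum.inl (Fin.last n)) fun i => liftPt (D.partner (Sum.inr i)))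
          (liftPt p) = liftPt (D.partner p) := by
        rintro (i | i) <;> simp [liftPt]
      intro p
      rw [h, h, D.partner_partner]) (by simp) (by simp)
  partner_ne := forall_pt_succ (by
    rintro (i | i)
    · simpa [liftPt] using liftPt_injective.ne (D.partner_ne (Sum.inl i))
    · simpa [liftPt] using liftPt_injective.ne (D.partner_ne (Sum.inr i))) (by simp) (by simp)
  color_partner := forall_pt_succ (by
    have h : ∀ p, Sum.elim (Fin.lastCases c fun i => D.color (Sum.inl i))
        (Fin.lastCases c fun i => D.color (Sum.inr i)) (liftPt p) = D.color p := by
      rintro (i | i) <;> simp [liftPt]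
    rintro (i | i)
    · simpa [liftPt] using (h _).trans (D.color_partner (Sum.inl i))
    · simpa [liftPt] using (h _).trans (D.color_partner (Sum.inr i))) (by simp) (by simp)
  noncrossing := by
    have hc : ∀ p, Sum.elim (Fin.lastCases c fun i => D.color (Sum.inl i))
        (Fin.lastCases c fun i => D.color (Sum.inr i)) (liftPt p) = D.color p := by
      rintro (i | i) <;> simp [liftPt]
    have hp : ∀ p, Sum.elim
        (Fin.lastCases (Sum.inr (Fin.last n)) fun i => liftPt (D.partner (Sum.inl i)))
        (Fin.lastCases (Sum.inl (Fin.last n)) fun i => liftPt (D.partner (Sum.inr i)))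
        (liftPt p) = liftPt (D.partner p) := by
      rintro (i | i) <;> simp [liftPt]
    have mono : ∀ {x y : Pt n}, pos (liftPt x) < pos (liftPt y) → pos x < pos y := by
      intro x y h
      by_contra! h'
      rcases h'.lt_or_eq with h' | h'
      · exact (pos_liftPt_lt h').not_gt h
      · rw [pos_injective h'] at h
        exact h.false
    refine forall_pt_succ (fun x => ?_) ?_ ?_
    · refine forall_pt_succ (fun y => ?_) ?_ ?_
      · rw [hc, hc, hp, hp]
        exact fun h ⟨h1, h2, h3⟩ => D.noncrossing x y h ⟨mono h1, mono h2, mono h3⟩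
      · rintro - ⟨h1, h2, h3⟩
        rw [hp] at h2 h3
        rcases D.partner x with i | i <;> simp [liftPt] at h1 h2 h3 <;> omega
      · rintro - ⟨h1, h2, h3⟩
        rw [hp] at h2 h3
        rcases D.partner x with i | i <;> simp [liftPt] at h1 h2 h3 <;> omega
    · rintro (i | i) - ⟨h1, h2, h3⟩ <;> simp at h1 h2 <;> omega
    · rintro (i | i) - ⟨h1, h2, h3⟩ <;> simp at h1 h2 <;> omega

lemma Diagram.isExtension_extend (D : Diagram n) (c : Bool) : IsExtension D (D.extend c) :=
  ⟨by rintro (i | i) <;> simp [extend, liftPt], by rintro (i | i) <;> simp [extend, liftPt],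
    by simp [extend]⟩

@[simp] lemma Diagram.extend_color_last (D : Diagram n) (c : Bool) :
    (D.extend c).color (Sum.inl (Fin.last n)) = c := by simp [extend]

namespace IsExtension

lemma partner_last' {D : Diagram n} {E : Diagram (n + 1)} (h : IsExtension D E) :
    E.partner (Sum.inr (Fin.last n)) = Sum.inl (Fin.last n) :=
  E.partner_eq_comm.1 h.partner_last

lemma color_last {D : Diagram n} {E : Diagram (n + 1)} (h : IsExtension D E) :
    E.color (Sum.inr (Fin.last n)) = E.color (Sum.inl (Fin.last n)) := by
  rw [← h.partner_last, E.color_partner]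

lemma eq_extend {D : Diagram n} {E : Diagram (n + 1)} (h : IsExtension D E) {c : Bool}
    (hc : E.color (Sum.inl (Fin.last n)) = c) : E = D.extend c := by
  have h' := D.isExtension_extend c
  refine Diagram.ext (funext ?_) (funext ?_)
  · refine forall_pt_succ (fun p => ?_) ?_ ?_
    · rw [h.color_lift, h'.color_lift]
    · rw [hc, Diagram.extend_color_last]
    · rw [h.color_last, h'.color_last, hc, Diagram.extend_color_last]
  · refine forall_pt_succ (fun p => ?_) ?_ ?_
    · rw [h.partner_lift, h'.partner_lift]
    · rw [h.partner_last, h'.partner_last]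
    · rw [h.partner_last', h'.partner_last']

lemma eq_of_eq {D D' : Diagram n} {E : Diagram (n + 1)} (h : IsExtension D E)
    (h' : IsExtension D' E) : D = D' :=
  Diagram.ext (funext fun p => by rw [← h.color_lift, h'.color_lift])
    (funext fun p => liftPt_injective (by rw [← h.partner_lift, h'.partner_lift]))

end IsExtension

lemma isExtension_swap {D : Diagram n} {E : Diagram (n + 1)} :
    IsExtension D.swap E.swap ↔ IsExtension D E :=
  ⟨fun h => ⟨fun p => by simpa using h.color_lift p, h.partner_lift, h.partner_last⟩,
    fun h => ⟨fun p => by simpa using h.color_lift p, h.partner_lift, h.partner_last⟩⟩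

lemma isExtension_swap_iff {D : Diagram n} {E : Diagram (n + 1)} :
    IsExtension D.swap E ↔ IsExtension D E.swap := by
  rw [← isExtension_swap, Diagram.swap_swap]

/-- A diagram whose last string is vertical is obtained by adding this string. -/
lemma exists_isExtension {E : Diagram (n + 1)}
    (h : E.partner (Sum.inl (Fin.last n)) = Sum.inr (Fin.last n)) :
    ∃ D : Diagram n, IsExtension D E := by
  have key : ∀ p : Pt n, ∃ q : Pt n, liftPt q = E.partner (liftPt p) := by
    intro p
    have h1 : E.partner (liftPt p) ≠ Sum.inl (Fin.last n) := fun e => by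
      rw [E.partner_eq_comm, h] at e
      exact liftPt_ne_inr_last p e.symm
    have h2 : E.partner (liftPt p) ≠ Sum.inr (Fin.last n) := fun e => by
      rw [← h] at e
      exact liftPt_ne_inl_last p (E.partner_injective e)
    revert h1 h2
    refine forall_pt_succ (motive := fun x => x ≠ _ → x ≠ _ → ∃ q : Pt n, liftPt q = x)
      (fun q _ _ => ⟨q, rfl⟩) (fun h => absurd rfl h) (fun _ h => absurd rfl h) _
  exact ⟨E.comap liftPt (fun _ _ => pos_liftPt_lt) key, fun _ => rfl,
    fun p => (E.map_comap_partner _ _ _ p).symm, h⟩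

end

section

variable {K : Type*} [CommRing K] {δ : K} {n : ℕ}

lemma incl_apply_of_isExtension (a : TL2 δ n) {D : Diagram n} {E : Diagram (n + 1)}
    (h : IsExtension D E) : incl δ n a E = a D := by
  classical
  change (∑ D', if IsExtension D' E then a D' else 0) = _
  rw [Finset.sum_eq_single D, if_pos h]
  · intro D' _ hne
    exact if_neg fun h' => hne (h'.eq_of_eq h)
  · simp

lemma incl_apply_of_not_isExtension (a : TL2 δ n) {E : Diagram (n + 1)}
    (h : ∀ D, ¬ IsExtension D E) : incl δ n a E = 0 := by
  classical
  exact Finset.sum_eq_zero fun D _ => if_neg (h D)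

lemma incl_mem_TS2 {a : TL2 δ n} (ha : a ∈ TS2 δ n) : incl δ n a ∈ TS2 δ (n + 1) := by
  rw [mem_TS2] at *
  intro E
  by_cases h : ∃ D, IsExtension D E
  · obtain ⟨D, h⟩ := h
    rw [incl_apply_of_isExtension a h, incl_apply_of_isExtension a (isExtension_swap.2 h), ha]
  · push Not at h
    rw [incl_apply_of_not_isExtension a h, incl_apply_of_not_isExtension]
    exact fun D hD => h D.swap (isExtension_swap_iff.2 hD)

lemma incl_diagramSum (P : Diagram n → Prop) :
    incl δ n (diagramSum δ P) = diagramSum δ fun E => ∃ D, P D ∧ IsExtension D E := by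
  classical
  funext E
  rw [diagramSum_apply]
  by_cases h : ∃ D, IsExtension D E
  · obtain ⟨D, h⟩ := h
    rw [incl_apply_of_isExtension _ h, diagramSum_apply]
    refine if_congr ⟨fun hD => ⟨D, hD, h⟩, ?_⟩ rfl rfl
    rintro ⟨D', hP, h'⟩
    rwa [h.eq_of_eq h']
  · push Not at h
    rw [incl_apply_of_not_isExtension _ h, if_neg]
    rintro ⟨D, -, hD⟩
    exact h D hD

lemma incl_orbitSum (D : Diagram n) : incl δ n (orbitSum δ D) =
    diagramSum δ fun E => IsExtension D E ∨ IsExtension D E.swap := by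
  rw [orbitSum, incl_diagramSum]
  congr 1
  funext E
  simp [or_and_right, exists_or, isExtension_swap_iff]

lemma mul_mul_mem_sandwich {x : TL2 δ (n + 1)} {a b : TL2 δ n} (ha : a ∈ TS2 δ n)
    (hb : b ∈ TS2 δ n) : incl δ n a * x * incl δ n b ∈ sandwich δ x :=
  Submodule.subset_span ⟨_, Submodule.mem_map_of_mem ha, _, Submodule.mem_map_of_mem hb, rfl⟩

lemma TS2incl_le : TS2incl δ n ≤ TS2 δ (n + 1) := by
  rintro _ ⟨a, ha, rfl⟩
  exact incl_mem_TS2 ha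

lemma sandwich_le {x : TL2 δ (n + 1)} (hx : x ∈ TS2 δ (n + 1)) :
    sandwich δ x ≤ TS2 δ (n + 1) := by
  refine Submodule.span_le.2 ?_
  rintro _ ⟨a, ha, b, hb, rfl⟩
  exact mul_mem_TS2 (mul_mem_TS2 (TS2incl_le ha) hx) (TS2incl_le hb)

end

/-! ### Coloured identity diagrams -/

section

variable {n : ℕ}

/-- The identity diagram whose strings have the given colours. -/
def Diagram.identity (col : Fin n → Bool) : Diagram n where
  color := Sum.elim col col
  partner := Sum.swap
  partner_partner := by simp
  partner_ne := by rintro (i | i) <;> simp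
  color_partner := by rintro (i | i) <;> simp
  noncrossing := by
    rintro (i | i) (j | j) - ⟨h1, h2, h3⟩ <;> simp at h1 h2 h3 <;> omega

lemma IsIdentity.eq_identity {D : Diagram n} (h : IsIdentity D) :
    D = Diagram.identity fun i => D.color (Sum.inl i) := by
  refine Diagram.ext (funext ?_) (funext ?_)
  · rintro (i | i)
    · rfl
    · exact (congrArg D.color (h i)).symm.trans (D.color_partner _)
  · rintro (i | i)
    · exact h i
    · exact D.partner_eq_comm.1 (h i)

lemma isIdentity_identity (col : Fin n → Bool) : IsIdentity (Diagram.identity col) := fun _ => rfl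

lemma certificate_identity_mul (D : Diagram n) :
    Certificate (Diagram.identity fun i => D.color (Sum.inl i)) D D
      (fun x => if x.1 = 2 then Sum.inr x.2 else Sum.inl x.2) := by
  set I := Diagram.identity fun i => D.color (Sum.inl i) with hI
  have c01 : ∀ i, component I D (0, i) (1, i) := fun i => component_upper I D (Sum.inl i)
  have co : ∀ p : Pt n, component I D (outer p) (lower p) := by
    rintro (i | i)
    · exact c01 i
    · exact (component I D).refl' _
  refine ⟨fun i => rfl, fun i => rfl, fun i => rfl, ?_, ?_, ?_, ?_, fun p => ?_⟩
  · rintro (i | i) <;> simp [outer]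
  · rintro ⟨r, i⟩
    fin_cases r
    · exact (component I D).refl' _
    · exact (component I D).symm' (c01 i)
    · exact (component I D).refl' _
  · rintro (i | i) <;> exact Or.inl rfl
  · have : ∀ p : Pt n, (if (lower p).1 = 2 then (Sum.inr (lower p).2 : Pt n)
        else Sum.inl (lower p).2) = p := by
      rintro (i | i) <;> simp [lower]
    intro p
    simp only [this, or_true]
  · exact (component I D).trans' (co p)
      ((component I D).trans' (component_lower I D p) ((component I D).symm' (co _)))

variable {K : Type*} [CommRing K] {δ : K}

/-- The sum of the identity diagrams with colourings of a given kind acts by restriction to the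
diagrams whose top edge is coloured in this way. -/
lemma identitySum_mul_apply (p : (Fin n → Bool) → Prop) [DecidablePred p] (a : TL2 δ n)
    (E : Diagram n) :
    (diagramSum δ (fun D : Diagram n => IsIdentity D ∧ p fun i => D.color (Sum.inl i)) * a) E =
      if p fun i => E.color (Sum.inl i) then a E else 0 := by
  change (∑ D₁, ∑ D₂, diagramSum δ (fun D : Diagram n => IsIdentity D ∧ p fun i =>
    D.color (Sum.inl i)) D₁ * a D₂ * structConst δ D₁ D₂ E) = _
  classical
  have key : ∀ D₁ D₂ : Diagram n, IsIdentity D₁ →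
      ¬ (D₁ = Diagram.identity (fun i => E.color (Sum.inl i)) ∧ D₂ = E) →
      structConst δ D₁ D₂ E = 0 := by
    intro D₁ D₂ h hne
    by_cases hc : ∀ i, D₁.color (Sum.inr i) = D₂.color (Sum.inl i)
    · have h1 : D₁ = Diagram.identity fun i => D₂.color (Sum.inl i) := by
        rw [h.eq_identity]
        congr 1
        funext i
        rw [← hc, ← h i, D₁.color_partner]
      rw [h1, (certificate_identity_mul D₂).structConst_eq, if_neg]
      rintro rfl
      exact hne ⟨h1, rfl⟩
    · exact structConst_eq_zero hc
  rw [Finset.sum_eq_single (Diagram.identity fun i => E.color (Sum.inl i)),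
    Finset.sum_eq_single E]
  · rw [diagramSum_apply, (certificate_identity_mul E).structConst_eq, if_pos rfl, mul_one]
    by_cases h : p fun i => E.color (Sum.inl i)
    · rw [if_pos h, if_pos ⟨isIdentity_identity _, h⟩, one_mul]
    · rw [if_neg h, if_neg fun h' => h h'.2, zero_mul]
  · intro D₂ _ h
    rw [key _ _ (isIdentity_identity _) fun h' => h h'.2, mul_zero]
  · simp
  · intro D₁ _ h
    refine Finset.sum_eq_zero fun D₂ _ => ?_
    by_cases h1 : IsIdentity D₁
    · rw [key _ _ h1 fun h' => h h'.1, mul_zero]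
    · rw [diagramSum_apply, if_neg fun h' => h1 h'.1, zero_mul, zero_mul]
  · simp

lemma e_eq {m : ℕ} (i : Fin m) : e δ i = diagramSum δ fun D : Diagram (m + 1) =>
    IsIdentity D ∧ D.color (Sum.inl i.castSucc) = D.color (Sum.inl i.succ) := by
  classical
  funext E
  change (piElt δ i.castSucc false * piElt δ i.succ false) E +
    (piElt δ i.castSucc true * piElt δ i.succ true) E = _
  have h : ∀ c (a : TL2 δ (m + 1)), (piElt δ i.castSucc c * a) E =
      if E.color (Sum.inl i.castSucc) = c then a E else 0 := by
    intro c a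
    exact identitySum_mul_apply (δ := δ) (fun col => col i.castSucc = c) a E
  rw [h, h, piElt, piElt, diagramSum_apply, diagramSum_apply, diagramSum_apply]
  cases E.color (Sum.inl i.castSucc) <;> cases E.color (Sum.inl i.succ) <;> simp

lemma e_mem_TS2 {m : ℕ} (i : Fin m) : e δ i ∈ TS2 δ (m + 1) := by
  rw [e_eq]
  refine diagramSum_mem_TS2 fun D => ?_
  simp [IsIdentity]

/-- The identity of the algebra: the sum of all coloured identity diagrams. -/
lemma identitySum_mul (a : TL2 δ n) : diagramSum δ (fun D : Diagram n => IsIdentity D) * a = a := by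
  classical
  funext E
  simpa using identitySum_mul_apply (δ := δ) (fun _ => True) a E

lemma incl_identitySum : incl δ n (diagramSum δ fun D : Diagram n => IsIdentity D) =
    diagramSum δ fun D : Diagram (n + 1) => IsIdentity D := by
  rw [incl_diagramSum]
  congr 1
  funext E
  refine propext ⟨?_, fun h => ?_⟩
  · rintro ⟨D, hD, h⟩ j
    cases j using Fin.lastCases with
    | last => exact h.partner_last
    | cast j => exact (h.partner_lift (Sum.inl j)).trans (by rw [hD j]; rfl)
  · obtain ⟨D, hD⟩ := exists_isExtension (h (Fin.last n))
    refine ⟨D, fun j => liftPt_injective ?_, hD⟩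
    rw [← hD.partner_lift]
    exact h j.castSucc

/-- The orbit sum of a diagram with a vertical last string lies in the span of the image of
`T^{S(2)}(n)` and of the products `a e b`. -/
lemma orbitSum_mem_of_vertical {m : ℕ} {E : Diagram (m + 2)}
    (h : E.partner (Sum.inl (Fin.last _)) = Sum.inr (Fin.last _)) :
    orbitSum δ E ∈ TS2incl δ (m + 1) ⊔ sandwich δ (e δ (Fin.last m)) := by
  classical
  obtain ⟨D, hD⟩ := exists_isExtension h
  have hDE : ∀ c G, IsExtension D G ↔ G = D.extend c ∨ G = D.extend !c := by
    intro c G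
    constructor
    · intro hG
      by_cases hc : G.color (Sum.inl (Fin.last _)) = c
      · exact Or.inl (hG.eq_extend hc)
      · exact Or.inr (hG.eq_extend (Bool.eq_not_of_ne hc))
    · rintro (rfl | rfl) <;> exact D.isExtension_extend _
  have hcol : ∀ c, (D.extend c).color (Sum.inl (Fin.last m).castSucc) =
      D.color (Sum.inl (Fin.last m)) := fun c =>
    (D.isExtension_extend c).color_lift (Sum.inl (Fin.last m))
  have hsum : ∀ c : Bool, orbitSum δ (D.extend c) + orbitSum δ (D.extend !c) =
      incl δ (m + 1) (orbitSum δ D) := by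
    intro c
    rw [incl_orbitSum]
    refine diagramSum_add (fun G => ?_) ?_
    · rw [hDE c, hDE c, Diagram.swap_eq_iff, Diagram.swap_eq_iff]
      tauto
    · intro G h1 h2
      have h3 : ∀ c d, D.extend c ≠ (D.extend d).swap := fun c d h => by
        simpa [hcol] using congrArg (fun E => E.color (Sum.inl (Fin.last m).castSucc)) h
      have h4 : D.extend c ≠ D.extend !c := fun h => by
        simpa using congrArg (fun E => E.color (Sum.inl (Fin.last _))) h
      rcases h1 with rfl | rfl <;> rcases h2 with h2 | h2
      · exact h4 h2
      · exact h3 _ _ h2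
      · exact h3 _ _ h2.symm
      · exact h4 (Diagram.swap_inj.1 h2)
  -- `1 * e * b` is the part of `b` in which the last two top points have equal colours.
  have he : orbitSum δ (D.extend (D.color (Sum.inl (Fin.last m)))) ∈
      sandwich δ (e δ (Fin.last m)) := by
    have h1 : incl δ (m + 1) (diagramSum δ fun D : Diagram (m + 1) => IsIdentity D) *
        e δ (Fin.last m) * incl δ (m + 1) (orbitSum δ D) =
        orbitSum δ (D.extend (D.color (Sum.inl (Fin.last m)))) := by
      rw [incl_identitySum, identitySum_mul, incl_orbitSum, e_eq]
      funext G
      rw [orbitSum, diagramSum_apply]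
      refine (identitySum_mul_apply (fun col => col (Fin.last m).castSucc = col (Fin.last m).succ)
        _ G).trans ?_
      rw [diagramSum_apply, ← ite_and]
      refine if_congr ?_ rfl rfl
      have h3 : ∀ G : Diagram (m + 2), IsExtension D G →
          (G.color (Sum.inl (Fin.last m).castSucc) = G.color (Sum.inl (Fin.last m).succ) ↔
            G = D.extend (D.color (Sum.inl (Fin.last m)))) := by
        intro G hG
        rcases (hDE (D.color (Sum.inl (Fin.last m))) G).1 hG with h | h
        · simp [h, hcol]
        · have : D.extend (!(D.color (Sum.inl (Fin.last m)))) ≠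
              D.extend (D.color (Sum.inl (Fin.last m))) := fun h => by
            simpa using congrArg (fun E => E.color (Sum.inl (Fin.last _))) h
          simp [h, hcol, this]
      constructor
      · rintro ⟨hc, hG | hG⟩
        · exact Or.inl ((h3 G hG).1 hc)
        · exact Or.inr (Diagram.swap_eq_iff.1 ((h3 _ hG).1 (by simpa using hc)))
      · rintro (rfl | rfl)
        · exact ⟨(h3 _ (D.isExtension_extend _)).2 rfl, Or.inl (D.isExtension_extend _)⟩
        · exact ⟨by simp [hcol], Or.inr (by simpa using D.isExtension_extend _)⟩
    rw [← h1]
    exact mul_mul_mem_sandwich (diagramSum_mem_TS2 fun D => Iff.rfl) (orbitSum_mem_TS2 D)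
  have hinc : incl δ (m + 1) (orbitSum δ D) ∈ TS2incl δ (m + 1) :=
    Submodule.mem_map_of_mem (orbitSum_mem_TS2 D)
  rcases (hDE (D.color (Sum.inl (Fin.last m))) E).1 hD with rfl | rfl
  · exact Submodule.mem_sup_right he
  · rw [eq_sub_of_add_eq' (hsum _)]
    exact Submodule.sub_mem _ (Submodule.mem_sup_left hinc) (Submodule.mem_sup_right he)

end

/-! ### Diagrams with two exceptional strings -/

/-- Two of `m + 2` places, together with the increasing enumeration of the other `m` places. -/
structure Splitting (m : ℕ) where
  left : Fin (m + 2)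
  right : Fin (m + 2)
  rest : Fin m → Fin (m + 2)
  left_lt_right : left < right
  strictMono : StrictMono rest
  rest_ne_left : ∀ k, rest k ≠ left
  rest_ne_right : ∀ k, rest k ≠ right
  cover : ∀ k, k = left ∨ k = right ∨ ∃ l, k = rest l

/-- The last but one of `m + 2` places. -/
abbrev penult (m : ℕ) : Fin (m + 2) := (Fin.last m).castSucc

/-- The places before the last two of `m + 2` places. -/
abbrev early {m : ℕ} (k : Fin m) : Fin (m + 2) := k.castSucc.castSucc

lemma cases_early {m : ℕ} (k : Fin (m + 2)) :
    (∃ l : Fin m, k = early l) ∨ k = penult m ∨ k = Fin.last (m + 1) := by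
  cases k using Fin.lastCases with
  | last => exact Or.inr (Or.inr rfl)
  | cast k =>
    cases k using Fin.lastCases with
    | last => exact Or.inr (Or.inl rfl)
    | cast k => exact Or.inl ⟨k, rfl⟩

namespace Splitting

variable {m : ℕ}

/-- The splitting in which the two chosen places are the last two. -/
def standard (m : ℕ) : Splitting m where
  left := penult m
  right := Fin.last (m + 1)
  rest := early
  left_lt_right := by simp [Fin.lt_def]
  strictMono := fun a b h => by simpa using h
  rest_ne_left := fun k => by simp [Fin.ext_iff]; omega
  rest_ne_right := fun k => by simp [Fin.ext_iff]; omega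
  cover := fun k => by rcases cases_early k with h | h | h <;> simp_all

lemma exists_of_lt {i j : Fin (m + 2)} (h : i < j) :
    ∃ S : Splitting m, S.left = i ∧ S.right = j := by
  have hc : ({i, j}ᶜ : Finset (Fin (m + 2))).card = m := by
    rw [Finset.card_compl, Finset.card_pair h.ne, Fintype.card_fin, Nat.add_sub_cancel]
  have hm : ∀ k, (({i, j}ᶜ : Finset (Fin (m + 2))).orderEmbOfFin hc) k ∈
      ({i, j}ᶜ : Finset (Fin (m + 2))) := Finset.orderEmbOfFin_mem _ hc
  refine ⟨⟨i, j, ({i, j}ᶜ : Finset (Fin (m + 2))).orderEmbOfFin hc, h,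
    OrderEmbedding.strictMono _, fun k => ?_, fun k => ?_, fun k => ?_⟩, rfl, rfl⟩
  · have := hm k; simp only [Finset.mem_compl, Finset.mem_insert, Finset.mem_singleton] at this
    tauto
  · have := hm k; simp only [Finset.mem_compl, Finset.mem_insert, Finset.mem_singleton] at this
    tauto
  · by_contra! hk
    have : k ∈ Set.range (({i, j}ᶜ : Finset (Fin (m + 2))).orderEmbOfFin hc) := by
      rw [Finset.range_orderEmbOfFin]
      simp [hk.1, hk.2.1]
    obtain ⟨l, hl⟩ := this
    exact hk.2.2 l hl.symm

@[simp] lemma standard_left : (standard m).left = penult m := rfl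

@[simp] lemma standard_right : (standard m).right = Fin.last (m + 1) := rfl

@[simp] lemma standard_rest (l : Fin m) : (standard m).rest l = early l := rfl

variable (S : Splitting m)

lemma rest_injective : Function.Injective S.rest := S.strictMono.injective

lemma cases_pt (p : Pt (m + 2)) : p = Sum.inl S.left ∨ p = Sum.inl S.right ∨
    (∃ l, p = Sum.inl (S.rest l)) ∨ (∃ l : Fin m, p = Sum.inr (early l)) ∨
    p = Sum.inr (penult m) ∨ p = Sum.inr (Fin.last (m + 1)) := by
  rcases p with k | k
  · rcases S.cover k with h | h | ⟨l, h⟩ <;> simp [h]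
  · rcases cases_early k with ⟨l, h⟩ | h | h <;> simp [h]

open Classical in
/-- The matching which joins the top places `S.rest` to the bottom places `early` in increasing
order. If `crossed` is `false`, then it joins the remaining two top points and the remaining two
bottom points; otherwise it joins `S.left` to the last bottom point and `S.right` to the last but
one, so that these two strings cross. -/
def partner (crossed : Bool) : Pt (m + 2) → Pt (m + 2)
  | Sum.inl k =>
    if k = S.left then bif crossed then Sum.inr (Fin.last _) else Sum.inl S.right
    else if k = S.right then bif crossed then Sum.inr (penult m) else Sum.inl S.left
    else if h : ∃ l, k = S.rest l then Sum.inr (early h.choose)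
    else Sum.inl k
  | Sum.inr k =>
    Fin.lastCases (bif crossed then Sum.inl S.left else Sum.inr (penult m))
      (Fin.lastCases (bif crossed then Sum.inl S.right else Sum.inr (Fin.last _))
        fun l => Sum.inl (S.rest l)) k

variable (x : Bool)

@[simp] lemma partner_left : S.partner x (Sum.inl S.left) =
    bif x then Sum.inr (Fin.last _) else Sum.inl S.right := by simp [partner]

@[simp] lemma partner_right : S.partner x (Sum.inl S.right) =
    bif x then Sum.inr (penult m) else Sum.inl S.left := by
  simp [partner, S.left_lt_right.ne']

@[simp] lemma partner_rest (l : Fin m) : S.partner x (Sum.inl (S.rest l)) =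
    Sum.inr (early l) := by
  have h : ∃ l', S.rest l = S.rest l' := ⟨l, rfl⟩
  simp only [partner, S.rest_ne_left, S.rest_ne_right, if_false, dif_pos h]
  rw [S.rest_injective h.choose_spec.symm]

@[simp] lemma partner_last : S.partner x (Sum.inr (Fin.last _)) =
    bif x then Sum.inl S.left else Sum.inr (penult m) := by simp [partner]

@[simp] lemma partner_penult : S.partner x (Sum.inr (penult m)) =
    bif x then Sum.inl S.right else Sum.inr (Fin.last _) := by simp [partner]

@[simp] lemma partner_early (l : Fin m) : S.partner x (Sum.inr (early l)) =
    Sum.inl (S.rest l) := by simp [partner]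

@[simp] lemma standard_partner_penult : (standard m).partner x (Sum.inl (penult m)) =
    bif x then Sum.inr (Fin.last _) else Sum.inl (Fin.last _) := (standard m).partner_left x

@[simp] lemma standard_partner_last : (standard m).partner x (Sum.inl (Fin.last _)) =
    bif x then Sum.inr (penult m) else Sum.inl (penult m) := (standard m).partner_right x

@[simp] lemma standard_partner_early (l : Fin m) : (standard m).partner x (Sum.inl (early l)) =
    Sum.inr (early l) := (standard m).partner_rest x l

/-- The colours of the matching `S.partner crossed` if the top points have the colours `col` and,
in the case `crossed = false`, the arc at the bottom has the colour `c`. -/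
def color (crossed : Bool) (col : Fin (m + 2) → Bool) (c : Bool) : Pt (m + 2) → Bool
  | Sum.inl k => col k
  | Sum.inr k =>
    Fin.lastCases (bif crossed then col S.left else c)
      (Fin.lastCases (bif crossed then col S.right else c) fun l => col (S.rest l)) k

variable (col : Fin (m + 2) → Bool) (c : Bool)

@[simp] lemma color_inl (k : Fin (m + 2)) : S.color x col c (Sum.inl k) = col k := rfl

@[simp] lemma color_last : S.color x col c (Sum.inr (Fin.last _)) =
    bif x then col S.left else c := by simp [color]

@[simp] lemma color_penult : S.color x col c (Sum.inr (penult m)) =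
    bif x then col S.right else c := by simp [color]

@[simp] lemma color_early (l : Fin m) : S.color x col c (Sum.inr (early l)) =
    col (S.rest l) := by simp [color]

/-- The condition on the colours of the top points under which strings of the same colour do not
cross in the matching `S.partner crossed`. In the crossed case only `S.right = Fin.last` is
considered. -/
structure Admissible : Prop where
  between : ∀ k, S.left < k → k < S.right → col k ≠ col S.left
  right_eq_last : x = true → S.right = Fin.last (m + 1)
  color_right : col S.right = xor x (col S.left)

variable {x col}

/-- The diagram with the matching `S.partner x`. -/
def diagram (h : S.Admissible x col) : Diagram (m + 2) where
  color := S.color x col c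
  partner := S.partner x
  partner_partner p := by
    rcases S.cases_pt p with rfl | rfl | ⟨l, rfl⟩ | ⟨l, rfl⟩ | rfl | rfl <;> cases x <;> simp
  partner_ne p := by
    rcases S.cases_pt p with rfl | rfl | ⟨l, rfl⟩ | ⟨l, rfl⟩ | rfl | rfl <;> cases x <;>
      simp [S.left_lt_right.ne, S.left_lt_right.ne', Fin.ext_iff]
  color_partner p := by
    have := h.color_right
    rcases S.cases_pt p with rfl | rfl | ⟨l, rfl⟩ | ⟨l, rfl⟩ | rfl | rfl <;> cases x <;> simp_all
  noncrossing p q hc hpq := by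
    obtain ⟨h1, h2, h3⟩ := hpq
    have hlr := S.left_lt_right
    rw [Fin.lt_def] at hlr
    have hr := h.color_right
    -- A string starting between the two chosen places has another colour than the first of them.
    have hb : ∀ l, (S.left : ℕ) < S.rest l → (S.rest l : ℕ) < S.right →
        col (S.rest l) ≠ col S.left := fun l => h.between (S.rest l)
    have hmono : ∀ k l : Fin m, (k : ℕ) < l → (S.rest k : ℕ) < S.rest l := fun k l =>
      @S.strictMono k l
    cases x
    · rcases S.cases_pt p with rfl | rfl | ⟨k, rfl⟩ | ⟨k, rfl⟩ | rfl | rfl <;>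
      rcases S.cases_pt q with rfl | rfl | ⟨l, rfl⟩ | ⟨l, rfl⟩ | rfl | rfl <;>
      simp at hc h1 h2 h3 <;>
      first
      | omega
      | exact hb l h1 h2 hc.symm
      | (have := hmono k l; have := hmono l k; have := k.2; have := l.2; omega)
    · have hx := congrArg Fin.val (h.right_eq_last rfl)
      rcases S.cases_pt p with rfl | rfl | ⟨k, rfl⟩ | ⟨k, rfl⟩ | rfl | rfl <;>
      rcases S.cases_pt q with rfl | rfl | ⟨l, rfl⟩ | ⟨l, rfl⟩ | rfl | rfl <;>
      simp at hc h1 h2 h3 hx <;>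
      first
      | omega
      | (rw [← hc] at hr; simp at hr)
      | exact hb l h1 (lt_of_le_of_ne (by omega) (Fin.val_ne_of_ne (S.rest_ne_right l))) hc.symm
      | (have := hmono k l; have := hmono l k; have := k.2; have := l.2; omega)

end Splitting

namespace Splitting

variable {m : ℕ} (S : Splitting m)

/-! ### The upper factor -/

/-- The end of the last string which the lower factor takes over as its last top point, whereas the
upper factor takes over the other end, `corner m (!x)`, as its last bottom point. For a cup-cap
(`x = false`) these are the bottom and the top end; for a transposition (`x = true`), which moves
both points across, they are interchanged. -/
def corner (m : ℕ) (x : Bool) : Pt (m + 2) :=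
  bif x then Sum.inl (Fin.last _) else Sum.inr (Fin.last _)

/-- The boundary of the upper factor as part of the boundary of `S.diagram`: the bottom points except
the last two, all top points except the last, and the point `corner m (!x)`, which becomes the
last bottom point. -/
def upperMap (x : Bool) : Pt (m + 1) → Pt (m + 2)
  | Sum.inl k => Sum.inl k.castSucc
  | Sum.inr k => Fin.lastCases (corner m (!x)) (fun k => Sum.inr (early k)) k

@[simp] lemma upperMap_inl (x : Bool) (k : Fin (m + 1)) :
    upperMap x (Sum.inl k) = Sum.inl k.castSucc := rfl

@[simp] lemma upperMap_castSucc (x : Bool) (k : Fin m) :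
    upperMap x (Sum.inr k.castSucc) = Sum.inr (early k) := by simp [upperMap]

@[simp] lemma upperMap_last (x : Bool) :
    upperMap x (Sum.inr (Fin.last m)) = corner m (!x) := by simp [upperMap]

lemma pos_upperMap_lt (x : Bool) (p q : Pt (m + 1)) (h : pos p < pos q) :
    pos (upperMap x p) < pos (upperMap x q) := by
  rcases p with i | i <;> rcases q with j | j
  · simpa using h
  · cases j using Fin.lastCases with
    | last => cases x <;> simp [corner] at h ⊢ <;> omega
    | cast j => simp at h ⊢; omega
  · simp at h; omega
  · cases i using Fin.lastCases with
    | last =>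
      cases j using Fin.lastCases with
      | last => simp at h
      | cast j => cases x <;> simp [corner] <;> omega
    | cast i =>
      cases j using Fin.lastCases with
      | last => simp at h; omega
      | cast j => simp at h ⊢; omega

lemma upperMap_ne_penult (x : Bool) (p : Pt (m + 1)) : upperMap x p ≠ Sum.inr (penult m) := by
  rcases p with i | i
  · simp
  · cases i using Fin.lastCases with
    | last => cases x <;> simp [corner, Fin.ext_iff]
    | cast i => simp

lemma upperMap_ne_corner (x : Bool) (p : Pt (m + 1)) : upperMap x p ≠ corner m x := by
  rcases p with i | i
  · cases x <;> simp [corner]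
  · cases i using Fin.lastCases with
    | last => cases x <;> simp [corner]
    | cast i => cases x <;> simp [corner]

lemma exists_upperMap_eq {x : Bool} {p : Pt (m + 2)} (h1 : p ≠ Sum.inr (penult m))
    (h2 : p ≠ corner m x) : ∃ q, upperMap x q = p := by
  rcases p with i | i
  · cases i using Fin.lastCases with
    | last =>
      refine ⟨Sum.inr (Fin.last m), ?_⟩
      cases x
      · simp [corner]
      · simp [corner] at h2
    | cast i => exact ⟨Sum.inl i, rfl⟩
  · rcases cases_early i with ⟨l, rfl⟩ | rfl | rfl
    · exact ⟨Sum.inr l.castSucc, by simp⟩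
    · exact absurd rfl h1
    · refine ⟨Sum.inr (Fin.last m), ?_⟩
      cases x
      · simp [corner] at h2
      · simp [corner]

variable {S} {x : Bool} {col : Fin (m + 2) → Bool} {c : Bool}

@[simp] lemma diagram_partner (h : S.Admissible x col) : (S.diagram c h).partner = S.partner x := rfl

@[simp] lemma diagram_color (h : S.Admissible x col) : (S.diagram c h).color = S.color x col c := rfl

lemma Admissible.partner_penult (h : S.Admissible x col) :
    S.partner x (Sum.inr (penult m)) = corner m x := by
  have := h.right_eq_last
  cases x <;> simp_all [corner]

lemma Admissible.partner_last_top (h : S.Admissible x col) (hx : x = true) :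
    S.partner x (Sum.inl (Fin.last _)) = Sum.inr (penult m) := by
  rw [← h.right_eq_last hx, partner_right, hx]
  rfl

lemma Admissible.exists_upperMap (h : S.Admissible x col) (p : Pt (m + 1)) :
    ∃ q, upperMap x q = (S.diagram c h).partner (upperMap x p) := by
  refine exists_upperMap_eq (fun e => ?_) (fun e => ?_)
  · rw [Diagram.partner_eq_comm, diagram_partner, h.partner_penult] at e
    exact upperMap_ne_corner x p e.symm
  · rw [← h.partner_penult, ← diagram_partner h (c := c)] at e
    exact upperMap_ne_penult x p (Diagram.partner_injective _ e)

/-- The upper factor: on top it has the matching of `S`, and the point `corner m (!x)` of `S.diagram`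
is pulled to the bottom edge. -/
def upperFactor (c : Bool) (h : S.Admissible x col) : Diagram (m + 1) :=
  (S.diagram c h).comap (upperMap x) (pos_upperMap_lt x) h.exists_upperMap

lemma upperFactor_color (h : S.Admissible x col) (p : Pt (m + 1)) :
    (upperFactor c h).color p = S.color x col c (upperMap x p) := rfl

lemma upperMap_upperFactor (h : S.Admissible x col) (p : Pt (m + 1)) :
    upperMap x ((upperFactor c h).partner p) = S.partner x (upperMap x p) :=
  (S.diagram c h).map_comap_partner _ _ _ p

/-- The upper factor with a vertical string whose colour is that of the last top point. -/
def upperExtended (c : Bool) (h : S.Admissible x col) : Diagram (m + 2) :=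
  (upperFactor c h).extend (col (Fin.last _))

lemma isExtension_upperExtended (h : S.Admissible x col) :
    IsExtension (upperFactor c h) (upperExtended c h) := Diagram.isExtension_extend _ _

lemma upperExtended_color_last (h : S.Admissible x col) :
    (upperExtended c h).color (Sum.inr (Fin.last _)) = col (Fin.last _) := by
  rw [(isExtension_upperExtended h).color_last]
  exact Diagram.extend_color_last _ _

lemma upperExtended_color_penult (h : S.Admissible x col) :
    (upperExtended c h).color (Sum.inr (penult m)) = S.color x col c (corner m (!x)) := by
  rw [← upperMap_last, ← upperFactor_color]
  exact (isExtension_upperExtended h).color_lift (Sum.inr (Fin.last m))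

lemma upperExtended_color_early (h : S.Admissible x col) (l : Fin m) :
    (upperExtended c h).color (Sum.inr (early l)) = col (S.rest l) := by
  refine ((isExtension_upperExtended h).color_lift (Sum.inr l.castSucc)).trans ?_
  simp [upperFactor_color]

lemma Admissible.color_corner (h : S.Admissible x col) :
    col (Fin.last _) = xor x (S.color x col c (corner m (!x))) := by
  have h1 := h.color_right
  have h2 := h.right_eq_last
  cases x <;> simp_all [corner]

lemma Admissible.standard (h : S.Admissible x col) : (standard m).Admissible x
    fun k => (upperExtended c h).color (Sum.inr k) where
  between k h1 h2 := by
    simp only [Splitting.standard, Fin.lt_def, Fin.val_castSucc, Fin.val_last] at h1 h2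
    omega
  right_eq_last _ := rfl
  color_right := by
    change (upperExtended c h).color (Sum.inr (Fin.last _)) =
      xor x ((upperExtended c h).color (Sum.inr (penult m)))
    rw [upperExtended_color_last, upperExtended_color_penult, h.color_corner (c := c)]

/-- The diagram of the transposition of the last two strings or of the last cup and cap, with
colours matching those of the upper factor. -/
def localFactor (c : Bool) (h : S.Admissible x col) : Diagram (m + 2) :=
  (Splitting.standard m).diagram c (h.standard (c := c))

lemma localFactor_partner (h : S.Admissible x col) :
    (localFactor c h).partner = (Splitting.standard m).partner x := rfl

lemma localFactor_color (h : S.Admissible x col) : (localFactor c h).color =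
    (Splitting.standard m).color x (fun k => (upperExtended c h).color (Sum.inr k)) c := rfl

/-- The outer point to which a point is connected when the upper factor is put on top of the local
factor. -/
def upperOuter (x : Bool) : Fin 3 × Fin (m + 2) → Pt (m + 2)
  | (0, k) => Sum.inl k
  | (1, k) => Fin.lastCases (Sum.inl (Fin.last _)) (fun k => upperMap x (Sum.inr k)) k
  | (2, k) => Sum.inr k

@[simp] lemma upperOuter_zero (k : Fin (m + 2)) : upperOuter x (0, k) = Sum.inl k := rfl

@[simp] lemma upperOuter_one_last :
    upperOuter x (1, Fin.last (m + 1)) = Sum.inl (Fin.last _) := by simp [upperOuter]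

@[simp] lemma upperOuter_one_castSucc (k : Fin (m + 1)) :
    upperOuter x (1, k.castSucc) = upperMap x (Sum.inr k) := by simp [upperOuter]

@[simp] lemma upperOuter_two (k : Fin (m + 2)) : upperOuter x (2, k) = Sum.inr k := rfl

lemma upperOuter_outer (p : Pt (m + 2)) : upperOuter x (outer p) = p := by
  rcases p with i | i <;> rfl

lemma upperOuter_upper_lift (p : Pt (m + 1)) :
    upperOuter x (upper (liftPt p)) = upperMap x p := by
  rcases p with i | i
  · rfl
  · simp [liftPt]

/-- The diagram of `S` is the composite of the upper factor and the local factor. -/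
lemma certificate_upper (h : S.Admissible x col) :
    Certificate (upperExtended c h) (localFactor c h) (S.diagram c h) (upperOuter x) := by
  have hx := h.right_eq_last
  set C := component (upperExtended c h) (localFactor c h) with hC
  have hE := isExtension_upperExtended (c := c) h
  have low : ∀ p q, (Splitting.standard m).partner x p = q → C (lower p) (lower q) := by
    rintro p _ rfl
    exact component_lower _ _ p
  have up : C (1, Fin.last _) (0, Fin.last _) := by
    refine C.symm' ?_
    have := component_upper (upperExtended c h) (localFactor c h) (Sum.inl (Fin.last _))
    rwa [hE.partner_last] at this
  have hmap : ∀ y, C y (outer (upperOuter x y)) := by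
    rintro ⟨r, i⟩
    fin_cases r
    · exact C.refl' _
    · rcases cases_early i with ⟨l, rfl⟩ | rfl | rfl
      · simpa using low _ _ ((Splitting.standard m).partner_rest x l)
      · have := low _ _ ((Splitting.standard m).partner_left x)
        cases x
        · simpa [corner] using C.trans' this up
        · simpa [corner] using this
      · simpa using up
    · exact C.refl' _
  have hjoin : ∀ p, C (outer p) (outer (S.partner x p)) → C (outer (S.partner x p))
      (outer (S.partner x (S.partner x p))) := by
    intro p hp
    have : S.partner x (S.partner x p) = p := (S.diagram c h).partner_partner p
    rw [this]
    exact C.symm' hp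
  refine ⟨fun i => rfl, fun i => ?_, fun i => ?_, upperOuter_outer, hmap, ?_, fun p => ?_,
    fun p => ?_⟩
  · cases i using Fin.lastCases with
    | last => exact (Diagram.extend_color_last _ _).symm
    | cast i => exact (hE.color_lift (Sum.inl i)).symm
  · have h1 := upperExtended_color_last (c := c) h
    have h2 := upperExtended_color_penult (c := c) h
    rw [diagram_color, localFactor_color]
    rcases cases_early i with ⟨l, rfl⟩ | rfl | rfl
    · simpa using (upperExtended_color_early h l).symm
    · cases x
      · simp
      · simpa [hx] using h1.symm
    · cases x
      · simp
      · simpa [corner] using h2.symm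
  · refine forall_pt_succ (fun p => Or.inr ?_) (Or.inl ?_) (Or.inl ?_)
    · rw [hE.partner_lift, upperOuter_upper_lift, upperOuter_upper_lift]
      exact upperMap_upperFactor h p
    · rw [hE.partner_last]
      simp
    · rw [hE.partner_last']
      simp
  · rw [localFactor_partner, diagram_partner]
    rcases (Splitting.standard m).cases_pt p with rfl | rfl | ⟨l, rfl⟩ | ⟨l, rfl⟩ | rfl | rfl
    · cases x <;> simp [corner]
    · cases x
      · simp [corner]
      · simp [h.partner_last_top rfl]
    · simp
    · simp
    · cases x
      · simp
      · simp [h.right_eq_last rfl]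
    · cases x <;> simp [corner]
  · have hpen : C (outer (Sum.inr (penult m))) (outer (S.partner x (Sum.inr (penult m)))) := by
      have := low _ _ ((Splitting.standard m).partner_penult x)
      rw [h.partner_penult]
      cases x
      · exact this
      · exact C.trans' this up
    rw [diagram_partner]
    by_cases h1 : p = Sum.inr (penult m)
    · rw [h1]; exact hpen
    by_cases h2 : p = corner m x
    · rw [h2, ← h.partner_penult]; exact hjoin _ hpen
    obtain ⟨q, rfl⟩ := exists_upperMap_eq h1 h2
    have h3 := C.symm' (hmap (upper (liftPt q)))
    have h4 := hmap (upper (liftPt ((upperFactor c h).partner q)))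
    rw [upperOuter_upper_lift] at h3 h4
    rw [upperMap_upperFactor] at h4
    have h5 := component_upper (upperExtended c h) (localFactor c h) (liftPt q)
    rw [hE.partner_lift] at h5
    exact C.trans' h3 (C.trans' h5 h4)

end Splitting

namespace Splitting

variable {m : ℕ} (S : Splitting m)

/-! ### The lower factor -/

/-- The boundary of the lower factor as part of the boundary of the given diagram: the top points
`S.rest`, all bottom points except the last, and the point `corner m x`, which becomes the last
top point. -/
def lowerMap (x : Bool) : Pt (m + 1) → Pt (m + 2)
  | Sum.inl k => Fin.lastCases (corner m x) (fun k => Sum.inl (S.rest k)) k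
  | Sum.inr k => Sum.inr k.castSucc

@[simp] lemma lowerMap_inr (x : Bool) (k : Fin (m + 1)) :
    S.lowerMap x (Sum.inr k) = Sum.inr k.castSucc := rfl

@[simp] lemma lowerMap_castSucc (x : Bool) (k : Fin m) :
    S.lowerMap x (Sum.inl k.castSucc) = Sum.inl (S.rest k) := by simp [lowerMap]

@[simp] lemma lowerMap_last (x : Bool) :
    S.lowerMap x (Sum.inl (Fin.last m)) = corner m x := by simp [lowerMap]

/-- The conditions under which the diagram `D` factorises along `S`: the string starting at the top
point `S.left` ends where it does in `S.partner x`, and the colours of the top points are admissible.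
Nothing is assumed about the other strings, which go into the lower factor. -/
structure Splits (x : Bool) (D : Diagram (m + 2)) : Prop where
  admissible : S.Admissible x fun k => D.color (Sum.inl k)
  partner_left : D.partner (Sum.inl S.left) =
    bif x then Sum.inr (Fin.last _) else Sum.inl S.right

variable {S} {x : Bool} {D : Diagram (m + 2)}

lemma Splits.pos_lowerMap_lt (h : S.Splits x D) (p q : Pt (m + 1)) (hpq : pos p < pos q) :
    pos (S.lowerMap x p) < pos (S.lowerMap x q) := by
  have hr := h.admissible.right_eq_last
  have hlast : ∀ k, x = true → (S.rest k : ℕ) < m + 1 := fun k hx => by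
    have := Fin.val_ne_of_ne (S.rest_ne_right k)
    rw [hr hx, Fin.val_last] at this
    omega
  rcases p with i | i <;> rcases q with j | j
  · cases i using Fin.lastCases with
    | last => simp at hpq; omega
    | cast i =>
      cases j using Fin.lastCases with
      | last =>
        have := hlast i
        cases x <;> simp [corner] at this ⊢ <;> omega
      | cast j => simpa using S.strictMono (by simpa using hpq)
  · cases i using Fin.lastCases with
    | last => cases x <;> simp [corner] <;> omega
    | cast i => simp; omega
  · simp at hpq; omega
  · simp at hpq ⊢; omega

lemma Splits.lowerMap_ne_left (h : S.Splits x D) (p : Pt (m + 1)) :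
    S.lowerMap x p ≠ Sum.inl S.left := by
  rcases p with i | i
  · cases i using Fin.lastCases with
    | last =>
      cases x
      · simp [corner]
      · simp [corner, ← h.admissible.right_eq_last rfl, S.left_lt_right.ne']
    | cast i => simpa using S.rest_ne_left i
  · simp

lemma lowerMap_ne (x : Bool) (p : Pt (m + 1)) :
    S.lowerMap x p ≠ bif x then Sum.inr (Fin.last _) else Sum.inl S.right := by
  rcases p with i | i
  · cases i using Fin.lastCases with
    | last => cases x <;> simp [corner]
    | cast i => cases x <;> simp [S.rest_ne_right]
  · cases x <;> simp

lemma Splits.exists_lowerMap_eq (h : S.Splits x D) {p : Pt (m + 2)} (h1 : p ≠ Sum.inl S.left)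
    (h2 : p ≠ bif x then Sum.inr (Fin.last _) else Sum.inl S.right) :
    ∃ q, S.lowerMap x q = p := by
  have hlast : corner m x = p → ∃ q, S.lowerMap x q = p := fun e =>
    ⟨Sum.inl (Fin.last m), by simpa using e⟩
  rcases p with i | i
  · rcases S.cover i with rfl | rfl | ⟨l, rfl⟩
    · exact absurd rfl h1
    · cases x
      · exact absurd rfl h2
      · exact hlast (by simp [corner, h.admissible.right_eq_last rfl])
    · exact ⟨Sum.inl l.castSucc, by simp⟩
  · cases i using Fin.lastCases with
    | last =>
      cases x
      · exact hlast rfl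
      · exact absurd rfl h2
    | cast i => exact ⟨Sum.inr i, rfl⟩

lemma Splits.exists_lowerMap (h : S.Splits x D) (p : Pt (m + 1)) :
    ∃ q, S.lowerMap x q = D.partner (S.lowerMap x p) := by
  refine h.exists_lowerMap_eq (fun e => ?_) (fun e => ?_)
  · rw [D.partner_eq_comm, h.partner_left] at e
    exact lowerMap_ne x p e.symm
  · rw [← h.partner_left] at e
    exact h.lowerMap_ne_left p (D.partner_injective e)

/-- The lower factor: the diagram without the string that starts at the top point `S.left`, with the
point `corner m x` as last top point. -/
def lowerFactor (h : S.Splits x D) : Diagram (m + 1) :=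
  D.comap (S.lowerMap x) h.pos_lowerMap_lt h.exists_lowerMap

lemma lowerMap_lowerFactor (h : S.Splits x D) (p : Pt (m + 1)) :
    S.lowerMap x ((lowerFactor h).partner p) = D.partner (S.lowerMap x p) :=
  D.map_comap_partner _ _ _ p

/-- The lower factor with a vertical string whose colour is that of the last bottom point. -/
def lowerExtended (h : S.Splits x D) : Diagram (m + 2) :=
  (lowerFactor h).extend (D.color (Sum.inr (Fin.last _)))

lemma isExtension_lowerExtended (h : S.Splits x D) :
    IsExtension (lowerFactor h) (lowerExtended h) := Diagram.isExtension_extend _ _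

lemma lowerExtended_color_last (h : S.Splits x D) :
    (lowerExtended h).color (Sum.inl (Fin.last _)) = D.color (Sum.inr (Fin.last _)) :=
  Diagram.extend_color_last _ _

lemma lowerExtended_color_inl (h : S.Splits x D) (k : Fin (m + 1)) :
    (lowerExtended h).color (Sum.inl k.castSucc) = D.color (S.lowerMap x (Sum.inl k)) :=
  (isExtension_lowerExtended h).color_lift (Sum.inl k)

variable (S) in
/-- The outer point to which a point is connected when the diagram of `S` is put on top of the lower
factor. -/
def lowerOuter (x : Bool) : Fin 3 × Fin (m + 2) → Pt (m + 2)
  | (0, k) => Sum.inl k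
  | (1, k) => Fin.lastCases (Sum.inr (Fin.last _)) (fun k => S.lowerMap x (Sum.inl k)) k
  | (2, k) => Sum.inr k

@[simp] lemma lowerOuter_zero (k : Fin (m + 2)) : S.lowerOuter x (0, k) = Sum.inl k := rfl

@[simp] lemma lowerOuter_one_last :
    S.lowerOuter x (1, Fin.last (m + 1)) = Sum.inr (Fin.last _) := by simp [lowerOuter]

@[simp] lemma lowerOuter_one_castSucc (k : Fin (m + 1)) :
    S.lowerOuter x (1, k.castSucc) = S.lowerMap x (Sum.inl k) := by simp [lowerOuter]

@[simp] lemma lowerOuter_two (k : Fin (m + 2)) : S.lowerOuter x (2, k) = Sum.inr k := rfl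

lemma lowerOuter_lower_lift (p : Pt (m + 1)) :
    S.lowerOuter x (lower (liftPt p)) = S.lowerMap x p := by
  rcases p with i | i
  · simp [liftPt]
  · rfl

/-- A diagram is the composite of the diagram of `S` and the lower factor. -/
lemma certificate_lower (h : S.Splits x D) :
    Certificate (S.diagram (D.color (Sum.inr (Fin.last _))) h.admissible) (lowerExtended h) D
      (S.lowerOuter x) := by
  have hx := h.admissible.right_eq_last
  set c := D.color (Sum.inr (Fin.last _)) with hc
  set C := component (S.diagram c h.admissible) (lowerExtended h) with hC
  have hE := isExtension_lowerExtended h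
  have up : ∀ p q, S.partner x p = q → C (upper p) (upper q) := by
    rintro p _ rfl
    exact component_upper _ _ p
  have low : C (1, Fin.last _) (2, Fin.last _) := by
    have := component_lower (S.diagram c h.admissible) (lowerExtended h) (Sum.inl (Fin.last _))
    rwa [hE.partner_last] at this
  have hmap : ∀ y, C y (outer (S.lowerOuter x y)) := by
    rintro ⟨r, i⟩
    fin_cases r
    · exact C.refl' _
    · rcases cases_early i with ⟨l, rfl⟩ | rfl | rfl
      · simpa using up _ _ (S.partner_early x l)
      · have := up _ _ (S.partner_penult x)
        cases x
        · simpa [corner] using C.trans' this low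
        · simpa [corner, hx] using this
      · simpa using low
    · exact C.refl' _
  have hleft : C (outer (Sum.inl S.left)) (outer (D.partner (Sum.inl S.left))) := by
    have := up _ _ (S.partner_left x)
    rw [h.partner_left]
    cases x
    · exact this
    · exact C.trans' this low
  refine ⟨fun i => ?_, fun i => rfl, fun i => ?_, ?_, hmap, fun p => ?_, ?_, fun p => ?_⟩
  · have h1 := lowerExtended_color_last h
    rcases cases_early i with ⟨l, rfl⟩ | rfl | rfl
    · rw [lowerExtended_color_inl h]
      simp
    · rw [lowerExtended_color_inl h]
      cases x
      · simp [corner, hc]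
      · simp [corner, hx]
    · rw [h1]
      cases x
      · simp [hc]
      · have := D.color_partner (Sum.inl S.left)
        rw [h.partner_left] at this
        simpa using this.symm
  · cases i using Fin.lastCases with
    | last => rw [hE.color_last, lowerExtended_color_last]
    | cast i => exact (hE.color_lift (Sum.inr i)).symm
  · rintro (i | i) <;> rfl
  · have hl := h.partner_left
    have hl' : D.partner (bif x then Sum.inr (Fin.last _) else Sum.inl S.right) =
        Sum.inl S.left := D.partner_eq_comm.1 hl
    rw [diagram_partner]
    rcases S.cases_pt p with rfl | rfl | ⟨l, rfl⟩ | ⟨l, rfl⟩ | rfl | rfl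
    · cases x <;> simp at hl <;> simp [hl]
    · cases x
      · simp at hl'
        simp [hl']
      · simp [h.admissible.partner_last_top rfl, corner, hx]
    · simp
    · simp
    · cases x <;> simp [corner, hx]
    · cases x
      · simp [corner]
      · simp at hl'
        simp [hl']
  · refine forall_pt_succ (fun p => Or.inr ?_) (Or.inl ?_) (Or.inl ?_)
    · rw [hE.partner_lift, lowerOuter_lower_lift, lowerOuter_lower_lift]
      exact lowerMap_lowerFactor h p
    · rw [hE.partner_last]
      simp
    · rw [hE.partner_last']
      simp
  · by_cases h1 : p = Sum.inl S.left
    · rw [h1]; exact hleft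
    by_cases h2 : p = D.partner (Sum.inl S.left)
    · rw [h2, D.partner_partner]; exact C.symm' hleft
    rw [h.partner_left] at h2
    obtain ⟨q, rfl⟩ := h.exists_lowerMap_eq h1 h2
    have h3 := C.symm' (hmap (lower (liftPt q)))
    have h4 := hmap (lower (liftPt ((lowerFactor h).partner q)))
    rw [lowerOuter_lower_lift] at h3 h4
    rw [lowerMap_lowerFactor] at h4
    have h5 := component_lower (S.diagram c h.admissible) (lowerExtended h) (liftPt q)
    rw [hE.partner_lift] at h5
    exact C.trans' h3 (C.trans' h5 h4)

end Splitting

/-! ### The elements `s`, `u`, `t` and their determination by colours -/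

lemma IsTransposition.eq_of_color {m : ℕ} {i : Fin m} {D E : Diagram (m + 1)}
    (hD : IsTransposition i D) (hE : IsTransposition i E)
    (h : ∀ k, D.color (Sum.inl k) = E.color (Sum.inl k)) : D = E := by
  have top : ∀ k, ∃ l, D.partner (Sum.inl k) = Sum.inr l ∧ E.partner (Sum.inl k) = Sum.inr l := by
    intro k
    by_cases h1 : k = i.castSucc
    · subst h1; exact ⟨_, hD.left, hE.left⟩
    by_cases h2 : k = i.succ
    · subst h2; exact ⟨_, hD.right, hE.right⟩
    exact ⟨_, hD.other k h1 h2, hE.other k h1 h2⟩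
  have bottom : ∀ l, ∃ k, D.partner (Sum.inl k) = Sum.inr l ∧ E.partner (Sum.inl k) = Sum.inr l := by
    intro l
    by_cases h1 : l = i.castSucc
    · subst h1; exact ⟨_, hD.right, hE.right⟩
    by_cases h2 : l = i.succ
    · subst h2; exact ⟨_, hD.left, hE.left⟩
    exact ⟨_, hD.other l h1 h2, hE.other l h1 h2⟩
  refine Diagram.ext (funext ?_) (funext ?_) <;> rintro (k | l)
  · exact h k
  · obtain ⟨k, h1, h2⟩ := bottom l
    rw [← D.color_partner, ← E.color_partner, D.partner_eq_comm.1 h1, E.partner_eq_comm.1 h2, h]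
  · obtain ⟨l, h1, h2⟩ := top k
    rw [h1, h2]
  · obtain ⟨k, h1, h2⟩ := bottom l
    rw [D.partner_eq_comm.1 h1, E.partner_eq_comm.1 h2]

lemma IsCupCap.eq_of_color {m : ℕ} {i : Fin m} {D E : Diagram (m + 1)}
    (hD : IsCupCap i D) (hE : IsCupCap i E)
    (h : ∀ k, D.color (Sum.inl k) = E.color (Sum.inl k))
    (h' : D.color (Sum.inr i.castSucc) = E.color (Sum.inr i.castSucc)) : D = E := by
  have hp : D.partner = E.partner := by
    funext p
    rcases p with k | k
    · by_cases h1 : k = i.castSucc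
      · rw [h1, hD.top, hE.top]
      by_cases h2 : k = i.succ
      · rw [h2, D.partner_eq_comm.1 hD.top, E.partner_eq_comm.1 hE.top]
      · rw [hD.other k h1 h2, hE.other k h1 h2]
    · by_cases h1 : k = i.castSucc
      · rw [h1, hD.bottom, hE.bottom]
      by_cases h2 : k = i.succ
      · rw [h2, D.partner_eq_comm.1 hD.bottom, E.partner_eq_comm.1 hE.bottom]
      · rw [D.partner_eq_comm.1 (hD.other k h1 h2), E.partner_eq_comm.1 (hE.other k h1 h2)]
  refine Diagram.ext (funext fun p => ?_) hp
  rcases p with k | k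
  · exact h k
  · by_cases h1 : k = i.castSucc
    · rw [h1, h']
    by_cases h2 : k = i.succ
    · rw [h2, ← hD.bottom, D.color_partner, h', ← E.color_partner, hE.bottom, hD.bottom]
    · rw [← D.color_partner, ← E.color_partner, D.partner_eq_comm.1 (hD.other k h1 h2),
        E.partner_eq_comm.1 (hE.other k h1 h2), h]

section

variable {K : Type*} [CommRing K] {δ : K} {m : ℕ}

lemma s_eq (i : Fin m) : s δ i = diagramSum δ fun D : Diagram (m + 1) => IsTransposition i D ∧
    D.color (Sum.inl i.succ) = !(D.color (Sum.inl i.castSucc)) := by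
  refine diagramSum_add (fun D => ?_) fun D => ?_ <;>
  cases D.color (Sum.inl i.castSucc) <;> cases D.color (Sum.inl i.succ) <;> simp

lemma u_eq (i : Fin m) : u δ i = diagramSum δ fun D : Diagram (m + 1) => IsCupCap i D ∧
    D.color (Sum.inr i.castSucc) = xor false (D.color (Sum.inl i.castSucc)) := by
  refine diagramSum_add (fun D => ?_) fun D => ?_ <;>
  cases D.color (Sum.inl i.castSucc) <;> cases D.color (Sum.inr i.castSucc) <;> simp

lemma t_eq (i : Fin m) : t δ i = diagramSum δ fun D : Diagram (m + 1) => IsCupCap i D ∧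
    D.color (Sum.inr i.castSucc) = xor true (D.color (Sum.inl i.castSucc)) := by
  refine diagramSum_add (fun D => ?_) fun D => ?_ <;>
  cases D.color (Sum.inl i.castSucc) <;> cases D.color (Sum.inr i.castSucc) <;> simp

lemma isTransposition_swap {i : Fin m} {D : Diagram (m + 1)} :
    IsTransposition i D.swap ↔ IsTransposition i D :=
  ⟨fun h => ⟨h.left, h.right, h.other⟩, fun h => ⟨h.left, h.right, h.other⟩⟩

lemma isCupCap_swap {i : Fin m} {D : Diagram (m + 1)} : IsCupCap i D.swap ↔ IsCupCap i D :=
  ⟨fun h => ⟨h.top, h.bottom, h.other⟩, fun h => ⟨h.top, h.bottom, h.other⟩⟩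

lemma transposition_swap (i : Fin m) (D : Diagram (m + 1)) :
    (IsTransposition i D.swap ∧
      D.swap.color (Sum.inl i.succ) = !(D.swap.color (Sum.inl i.castSucc))) ↔
    (IsTransposition i D ∧ D.color (Sum.inl i.succ) = !(D.color (Sum.inl i.castSucc))) := by
  simp [isTransposition_swap]

lemma cupCap_swap (y : Bool) (i : Fin m) (D : Diagram (m + 1)) :
    (IsCupCap i D.swap ∧
      D.swap.color (Sum.inr i.castSucc) = xor y (D.swap.color (Sum.inl i.castSucc))) ↔
    (IsCupCap i D ∧ D.color (Sum.inr i.castSucc) = xor y (D.color (Sum.inl i.castSucc))) := by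
  simp [isCupCap_swap]

lemma s_mem_TS2 (i : Fin m) : s δ i ∈ TS2 δ (m + 1) := by
  rw [s_eq]; exact diagramSum_mem_TS2 (transposition_swap i)

lemma u_mem_TS2 (i : Fin m) : u δ i ∈ TS2 δ (m + 1) := by
  rw [u_eq]; exact diagramSum_mem_TS2 (cupCap_swap _ i)

lemma t_mem_TS2 (i : Fin m) : t δ i ∈ TS2 δ (m + 1) := by
  rw [t_eq]; exact diagramSum_mem_TS2 (cupCap_swap _ i)

/-! ### Factorisation of diagrams -/

namespace Splitting

variable {S : Splitting m} {x : Bool}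

/-- The product of the upper factor with a sum of diagrams of the local type. A diagram in the sum
has to be determined by the colours on its top edge, where the last colour is in turn determined
by the last but one. -/
lemma incl_upperFactor_mul {col : Fin (m + 2) → Bool} {c : Bool} (h : S.Admissible x col)
    {Q : Diagram (m + 2) → Prop} (hsw : ∀ w, Q w.swap ↔ Q w) (hQ : Q (localFactor c h))
    (hlast : ∀ w, Q w → w.color (Sum.inl (Fin.last _)) = xor x (w.color (Sum.inl (penult m))))
    (huniq : ∀ v w, Q v → Q w → (∀ k, v.color (Sum.inl k) = w.color (Sum.inl k)) → v = w) :
    incl δ (m + 1) (orbitSum δ (upperFactor c h)) * diagramSum δ Q =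
      orbitSum δ (S.diagram c h) := by
  rw [incl_orbitSum]
  refine diagramSum_mul_diagramSum (certificate_upper h) (isExtension_upperExtended h) hQ
    (fun w => (hsw w).2) fun v w hv hw hc => ?_
  have h1 : v = upperExtended c h := by
    refine hv.eq_extend ?_
    rw [← hv.color_last, hc, hlast w hw, ← hc, h.color_corner (c := c),
      ← upperExtended_color_penult h]
    congr 1
    exact (hv.color_lift (Sum.inr (Fin.last m))).trans
      ((isExtension_upperExtended h).color_lift (Sum.inr (Fin.last m))).symm
  refine ⟨h1, huniq _ _ hw hQ fun k => ?_⟩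
  rw [← hc, h1]
  exact (certificate_upper h).color_middle k

lemma orbitSum_mul_incl_lowerFactor {D : Diagram (m + 2)} (h : S.Splits x D) :
    orbitSum δ (S.diagram (D.color (Sum.inr (Fin.last _))) h.admissible) *
      incl δ (m + 1) (orbitSum δ (lowerFactor h)) = orbitSum δ D := by
  set F := S.diagram (D.color (Sum.inr (Fin.last _))) h.admissible with hF
  have hE := isExtension_lowerExtended h
  have hcert := certificate_lower h
  have e : orbitSum δ F = diagramSum δ fun v => v = F ∨ v.swap = F := by
    simp only [orbitSum, Diagram.swap_eq_iff]
  rw [e, incl_orbitSum]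
  refine diagramSum_mul_diagramSum hcert rfl (Or.inl hE) (fun w hw => ?_)
    fun v w hv hw hc => ⟨hv, ?_⟩
  · rw [Diagram.swap_swap]
    exact hw.symm
  · subst hv
    have hc' : ∀ k, w.color (Sum.inl k) = (lowerExtended h).color (Sum.inl k) := fun k =>
      (hc k).symm.trans (hcert.color_middle k)
    rcases hw with hw | hw
    · exact hw.eq_extend ((hc' _).trans (lowerExtended_color_last h))
    · have h1 := (hw.color_lift (Sum.inl 0)).trans (hE.color_lift (Sum.inl 0)).symm
      have h2 := hc' (Fin.castSucc 0)
      rw [Diagram.swap_color] at h1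
      change (!(w.color (Sum.inl (Fin.castSucc 0)))) = _ at h1
      rw [h2] at h1
      change (!_) = (lowerExtended h).color (Sum.inl (Fin.castSucc 0)) at h1
      simp at h1

lemma orbitSum_mem_sandwich {D : Diagram (m + 2)} (h : S.Splits x D)
    {Q : Diagram (m + 2) → Prop} (hsw : ∀ w, Q w.swap ↔ Q w)
    (hQ : Q (localFactor (D.color (Sum.inr (Fin.last _))) h.admissible))
    (hlast : ∀ w, Q w → w.color (Sum.inl (Fin.last _)) = xor x (w.color (Sum.inl (penult m))))
    (huniq : ∀ v w, Q v → Q w → (∀ k, v.color (Sum.inl k) = w.color (Sum.inl k)) → v = w) :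
    orbitSum δ D ∈ sandwich δ (diagramSum δ Q) := by
  rw [← orbitSum_mul_incl_lowerFactor h,
    ← incl_upperFactor_mul h.admissible hsw hQ hlast huniq]
  exact mul_mul_mem_sandwich (orbitSum_mem_TS2 _) (orbitSum_mem_TS2 _)

lemma orbitSum_mem_sandwich_s {D : Diagram (m + 2)} (h : S.Splits true D) :
    orbitSum δ D ∈ sandwich δ (s δ (Fin.last m)) := by
  rw [s_eq]
  refine orbitSum_mem_sandwich h (transposition_swap _) ?_ (fun w hw => ?_)
    fun v w hv hw => hv.1.eq_of_color hw.1
  · have := h.admissible.standard (c := D.color (Sum.inr (Fin.last _)))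
    refine ⟨⟨?_, ?_, fun j h1 h2 => ?_⟩, ?_⟩
    · exact (Splitting.standard m).partner_left true
    · exact (Splitting.standard m).partner_right true
    · rcases cases_early j with ⟨l, rfl⟩ | rfl | rfl
      · exact (Splitting.standard m).partner_rest true l
      · exact absurd rfl h1
      · exact absurd rfl h2
    · exact this.color_right.trans (Bool.true_xor _)
  · simpa using hw.2

lemma orbitSum_mem_sandwich_cupCap {D : Diagram (m + 2)} (h : S.Splits false D) :
    orbitSum δ D ∈ sandwich δ (u δ (Fin.last m)) ∨
      orbitSum δ D ∈ sandwich δ (t δ (Fin.last m)) := by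
  set c := D.color (Sum.inr (Fin.last _)) with hc
  have key : ∀ y : Bool, c = xor y ((localFactor c h.admissible).color (Sum.inl (penult m))) →
      orbitSum δ D ∈ sandwich δ (diagramSum δ fun D : Diagram (m + 2) =>
        IsCupCap (Fin.last m) D ∧ D.color (Sum.inr (Fin.last m).castSucc) =
          xor y (D.color (Sum.inl (Fin.last m).castSucc))) := by
    intro y hy
    refine orbitSum_mem_sandwich h (cupCap_swap y _) ?_ (fun w hw => ?_)
      fun v w hv hw hvw => hv.1.eq_of_color hw.1 hvw (by rw [hv.2, hw.2, hvw])
    · refine ⟨⟨?_, ?_, fun j h1 h2 => ?_⟩, ?_⟩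
      · exact (Splitting.standard m).partner_left false
      · exact (Splitting.standard m).partner_penult false
      · rcases cases_early j with ⟨l, rfl⟩ | rfl | rfl
        · exact (Splitting.standard m).partner_rest false l
        · exact absurd rfl h1
        · exact absurd rfl h2
      · have hb : (localFactor c h.admissible).color (Sum.inr (penult m)) = c := by
          rw [localFactor_color, color_penult, cond_false]
        exact hb.trans hy
    · have := w.color_partner (Sum.inl (penult m))
      rw [hw.1.top] at this
      simpa using this
  by_cases hy : c = (localFactor c h.admissible).color (Sum.inl (penult m))
  · left
    rw [u_eq]
    exact key false (by simpa using hy)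
  · right
    rw [t_eq]
    exact key true (by simpa using Bool.eq_not_of_ne hy)

end Splitting

/-! ### Finding the two exceptional strings -/

/-- Among the arcs joining two top points there is one that encloses no point of its own colour. -/
lemma exists_splits_of_top_arc {D : Diagram (m + 2)} {i₀ j₀ : Fin (m + 2)}
    (h₀ : D.partner (Sum.inl i₀) = Sum.inl j₀) : ∃ S : Splitting m, S.Splits false D := by
  classical
  -- The arc is chosen as short as possible.
  obtain ⟨⟨i, j⟩, hij, hmin⟩ : ∃ p : Fin (m + 2) × Fin (m + 2),
      (p.1 < p.2 ∧ D.partner (Sum.inl p.1) = Sum.inl p.2) ∧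
      ∀ q : Fin (m + 2) × Fin (m + 2), q.1 < q.2 → D.partner (Sum.inl q.1) = Sum.inl q.2 →
        (p.2 : ℕ) - p.1 ≤ q.2 - q.1 := by
    have hne : (Finset.univ.filter fun p : Fin (m + 2) × Fin (m + 2) =>
        p.1 < p.2 ∧ D.partner (Sum.inl p.1) = Sum.inl p.2).Nonempty := by
      rcases lt_trichotomy i₀ j₀ with h | rfl | h
      · exact ⟨(i₀, j₀), by simp [h, h₀]⟩
      · exact absurd h₀ (D.partner_ne _)
      · exact ⟨(j₀, i₀), by simp [h, D.partner_eq_comm.1 h₀]⟩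
    obtain ⟨p, hp, hmin⟩ := Finset.exists_min_image _ (fun p => (p.2 : ℕ) - p.1) hne
    exact ⟨p, by simpa using hp, fun q h1 h2 => hmin q (by simp [h1, h2])⟩
  obtain ⟨hlt, hp⟩ := hij
  obtain ⟨S, rfl, rfl⟩ := Splitting.exists_of_lt hlt
  dsimp only at hp hmin
  refine ⟨S, ⟨fun k h1 h2 hk => ?_, fun h => by simp at h, ?_⟩, hp⟩
  · have hp' := D.partner_eq_comm.1 hp
    rw [Fin.lt_def] at h1 h2
    rcases hl : D.partner (Sum.inl k) with l | l
    · have hl' := D.partner_eq_comm.1 hl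
      have hcl : D.color (Sum.inl l) = D.color (Sum.inl S.left) := by
        rw [← hl, D.color_partner, hk]
      have n1 := D.noncrossing (Sum.inl l) (Sum.inl S.left) hcl
      have n2 := D.noncrossing (Sum.inl S.left) (Sum.inl k) hk.symm
      rw [hl', hp] at n1
      rw [hl, hp] at n2
      simp only [pos_inl] at n1 n2
      have l1 : l ≠ S.left := by
        rintro rfl
        rw [hp, Sum.inl.injEq] at hl'
        exact h2.ne (by rw [hl'])
      have l2 : l ≠ S.right := by
        rintro rfl
        rw [hp', Sum.inl.injEq] at hl'
        exact h1.ne (by rw [hl'])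
      have l3 : l ≠ k := by
        rintro rfl
        exact D.partner_ne _ hl
      have l1' := Fin.val_ne_of_ne l1
      have l2' := Fin.val_ne_of_ne l2
      rcases lt_or_gt_of_ne l3 with h | h
      · have := hmin (l, k) h hl'
        rw [Fin.lt_def] at h
        simp only at this
        omega
      · have := hmin (k, l) h hl
        rw [Fin.lt_def] at h
        simp only at this
        omega
    · have n2 := D.noncrossing (Sum.inl S.left) (Sum.inl k) hk.symm
      rw [hl, hp] at n2
      simp only [pos_inl, pos_inr] at n2
      omega
  · rw [Bool.false_xor, ← hp, D.color_partner]

/-- In a diagram without arcs at the top edge the string that ends at the last bottom point is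
vertical or else crosses all strings starting on its right, which therefore have the other colour. -/
lemma exists_splits_of_no_top_arc {D : Diagram (m + 2)}
    (h₀ : ∀ i j, D.partner (Sum.inl i) ≠ Sum.inl j) :
    D.partner (Sum.inl (Fin.last _)) = Sum.inr (Fin.last _) ∨
      ∃ S : Splitting m, S.Splits true D := by
  have hb : ∀ i, ∃ j, D.partner (Sum.inl i) = Sum.inr j := fun i => by
    rcases h : D.partner (Sum.inl i) with j | j
    · exact absurd h (h₀ i j)
    · exact ⟨j, rfl⟩
  choose g hg using hb
  have hinj : Function.Injective g := fun i j h => Sum.inl_injective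
    (D.partner_injective (by rw [hg, hg, h]))
  obtain ⟨q, hq⟩ := Finite.surjective_of_injective hinj (Fin.last _)
  by_cases hlast : q = Fin.last _
  · left
    rw [← hlast, hg, hq, hlast]
  right
  obtain ⟨S, rfl, hr⟩ := Splitting.exists_of_lt (Fin.lt_last_iff_ne_last.2 hlast)
  have key : ∀ k, S.left < k → D.color (Sum.inl k) ≠ D.color (Sum.inl S.left) := by
    intro k hk hc
    have hne : g k ≠ Fin.last _ := fun h => hk.ne (hinj (hq.trans h.symm))
    have := D.noncrossing (Sum.inl S.left) (Sum.inl k) hc.symm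
    rw [hg, hg, hq] at this
    have h1 := Fin.val_ne_of_ne hne
    rw [Fin.lt_def] at hk
    simp only [pos_inl, pos_inr, Fin.val_last] at this h1
    omega
  exact ⟨S, ⟨fun k h1 _ => key k h1, fun _ => hr, by
    simpa using Bool.eq_not_of_ne (key _ S.left_lt_right)⟩, by rw [hg, hq]; rfl⟩

end

end DiluteTL

end

theorem proposition6p1 {K : Type*} [CommRing K] (δ : K) (n : ℕ) (hn : 1 ≤ n) :
    DiluteTL.TS2 δ (n + 1) =
      DiluteTL.TS2incl δ n ⊔
        DiluteTL.sandwich δ (DiluteTL.e δ (DiluteTL.lastIndex n hn)) ⊔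
        DiluteTL.sandwich δ (DiluteTL.s δ (DiluteTL.lastIndex n hn)) ⊔
        DiluteTL.sandwich δ (DiluteTL.u δ (DiluteTL.lastIndex n hn)) ⊔
        DiluteTL.sandwich δ (DiluteTL.t δ (DiluteTL.lastIndex n hn)) := by
  open DiluteTL in
  refine le_antisymm ?_ (sup_le (sup_le (sup_le (sup_le TS2incl_le (sandwich_le (e_mem_TS2 _)))
    (sandwich_le (s_mem_TS2 _))) (sandwich_le (u_mem_TS2 _))) (sandwich_le (t_mem_TS2 _)))
  obtain ⟨m, rfl⟩ : ∃ m, n = m + 1 := ⟨n - 1, by omega⟩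
  have hi : DiluteTL.lastIndex (m + 1) hn = Fin.last m := rfl
  rw [hi]
  refine DiluteTL.TS2_le_of_orbitSum_mem fun D => ?_
  by_cases h : ∃ i j, D.partner (Sum.inl i) = Sum.inl j
  · obtain ⟨i, j, h⟩ := h
    obtain ⟨S, hS⟩ := DiluteTL.exists_splits_of_top_arc h
    rcases DiluteTL.Splitting.orbitSum_mem_sandwich_cupCap (δ := δ) hS with h | h
    · exact Submodule.mem_sup_left (Submodule.mem_sup_right h)
    · exact Submodule.mem_sup_right h
  · push Not at h
    rcases DiluteTL.exists_splits_of_no_top_arc h with h | ⟨S, hS⟩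
    · exact Submodule.mem_sup_left (Submodule.mem_sup_left (Submodule.mem_sup_left
        (DiluteTL.orbitSum_mem_of_vertical h)))
    · exact Submodule.mem_sup_left (Submodule.mem_sup_left (Submodule.mem_sup_right
        (DiluteTL.Splitting.orbitSum_mem_sandwich_s hS)))
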